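/- Let $(M,\eta,\omega)$ be a connected cosymplectic manifold of dimension $2n+1$ (Hausdorff, second countable, smooth, without boundary): $\eta$ is a smooth closed $1$-form and $\omega$ a smooth closed $2$-form on $M$ such that $\eta\wedge\omega^n$ is a volume form. Let $\xi$ be its Reeb vector field, defined by $\eta(\xi)=1$ and $\iota_\xi\omega=0$. Suppose that $(M,\eta,\omega)$ is regular: $\xi$ is complete, every point of $M$ is the centre of a cubical chart in which $\xi$ is the first coordinate field and which every orbit of $\xi$ meets in at most one slice (obtained by fixing all coordinates except the first), and the space of orbits $B=M/\!\sim$ is Hausdorff in the quotient topology. (Then $B$ is a smooth manifold and $M\to B$ is a principal bundle with group $\mathbb R$ or $\mathbb R/T\mathbb Z$ acting by the flow of $\xi$. If $M$ is compact, completeness and the Hausdorff property of $B$ follow from the condition on charts.) Let $\mathrm{Cosymp}(M)$ be the group of smooth diffeomorphisms $\phi$ of $M$ with $\phi^*\eta=\eta$ and $\phi^*\omega=\omega$, with the $C^\infty$ compact-open topology, and let $\mathrm{Cosymp}_0(M)$ be the connected component of the identity. Then the center of $\mathrm{Cosymp}_0(M)$ consists exactly of the flow of the Reeb vector field: if $\{\psi_t\}_{t\in\mathbb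 R}$ is the flow of $\xi$, then $$Z(\mathrm{Cosymp}_0(M))=\{\psi_t : t\in\mathbb R\}.$$ -/

import Mathlib

open Set Topology
open scoped Manifold ContDiff

noncomputable section

namespace Cosymplectic

section General

variable {E : Type*} [NormedAddCommGroup E] [NormedSpace ℝ E]

/-! ### Differential forms on a manifold modelled on `E` -/

/-- A (not necessarily smooth) differential `k`-form on `M`: an alternating `k`-linear form on
each tangent space. -/
abbrev DiffForm (E : Type*) [NormedAddCommGroup E] [NormedSpace ℝ E]
    (M : Type*) [TopologicalSpace M] [ChartedSpace E M] (k : ℕ) : Type _ :=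
  ∀ x : M, TangentSpace 𝓘(ℝ, E) x [⋀^Fin k]→L[ℝ] ℝ

variable {M : Type*} [TopologicalSpace M] [ChartedSpace E M]

/-- The pullback `φ^* Ω` of a form under a map `φ : M → M`. -/
def pullback {k : ℕ} (φ : M → M) (Ω : DiffForm E M k) : DiffForm E M k :=
  fun x => (Ω (φ x)).compContinuousLinearMap (mfderiv 𝓘(ℝ, E) 𝓘(ℝ, E) φ x)

/-- The expression of a form in the chart `e`: the pullback of `Ω` under `e.symm`, a form on the
open subset `e.target` of `E`. -/
def chartRep {k : ℕ} (e : OpenPartialHomeomorph M E) (Ω : DiffForm E M k) :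
    E → E [⋀^Fin k]→L[ℝ] ℝ :=
  fun y => (Ω (e.symm y)).compContinuousLinearMap
    (mfderiv 𝓘(ℝ, E) 𝓘(ℝ, E) e.symm y : E →L[ℝ] TangentSpace 𝓘(ℝ, E) (e.symm y))

/-- Smoothness of a form: all its chart expressions are smooth. -/
def IsSmoothForm {k : ℕ} (Ω : DiffForm E M k) : Prop :=
  ∀ e ∈ IsManifold.maximalAtlas 𝓘(ℝ, E) ∞ M, ContDiffOn ℝ ∞ (chartRep e Ω) e.target

/-- Closedness of a form: `d Ω = 0` in every chart. -/
def IsClosedForm {k : ℕ} (Ω : DiffForm E M k) : Prop :=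
  ∀ e ∈ IsManifold.maximalAtlas 𝓘(ℝ, E) ∞ M, ∀ y ∈ e.target, extDeriv (chartRep e Ω) y = 0

/-! ### Cosymplectic structures -/

/-- The value of `η ∧ Ω ^ n` at `x` on the vectors `v 0, …, v (2 n)`. -/
def wedgeTop (n : ℕ) (η : DiffForm E M 1) (Ω : DiffForm E M 2) (x : M)
    (v : Fin (2 * n + 1) → TangentSpace 𝓘(ℝ, E) x) : ℝ :=
  (1 / 2 ^ n) * ∑ σ : Equiv.Perm (Fin (2 * n + 1)),
    ((Equiv.Perm.sign σ : ℤ) : ℝ) * (η x ![v (σ 0)] *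
      ∏ i : Fin n, Ω x ![v (σ ⟨2 * i + 1, by omega⟩), v (σ ⟨2 * i + 2, by omega⟩)])

/-- `(η, Ω)` is a cosymplectic structure on the `(2 n + 1)`-dimensional manifold `M`: smooth
closed forms of degrees one and two such that `η ∧ Ω ^ n` is a volume form, that is, vanishes
at no point. -/
structure IsCosymplectic (n : ℕ) (η : DiffForm E M 1) (Ω : DiffForm E M 2) : Prop where
  smooth_one : IsSmoothForm η
  smooth_two : IsSmoothForm Ω
  closed_one : IsClosedForm η
  closed_two : IsClosedForm Ω
  volume : ∀ x : M, ∃ v, wedgeTop n η Ω x v ≠ 0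

/-- `ξ` is the Reeb vector field: `η(ξ) = 1` and `ι_ξ Ω = 0`. -/
def IsReebField (η : DiffForm E M 1) (Ω : DiffForm E M 2)
    (ξ : ∀ x : M, TangentSpace 𝓘(ℝ, E) x) : Prop :=
  ∀ x : M, η x ![ξ x] = 1 ∧ ∀ w : TangentSpace 𝓘(ℝ, E) x, Ω x ![ξ x, w] = 0

/-! ### Regularity -/

/-- `x` and `y` lie on the same (complete) integral curve of `ξ`. -/
def SameOrbit (ξ : ∀ x : M, TangentSpace 𝓘(ℝ, E) x) (x y : M) : Prop :=
  ∃ γ : ℝ → M, IsMIntegralCurve (I := 𝓘(ℝ, E)) γ ξ ∧ ∃ s t : ℝ, γ s = x ∧ γ t = y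

/-- The space of orbits, with the quotient topology. -/
abbrev OrbitSpace (ξ : ∀ x : M, TangentSpace 𝓘(ℝ, E) x) : Type _ := Quot (SameOrbit ξ)

end General

/-- The vector field `ξ` is regular:
it is complete, every point is the centre of a cubical chart in which `ξ` is the first coordinate
field and which every orbit meets in at most one slice `z 1 = c 1, …, z m = c m`, and the space
of orbits is Hausdorff. (So the orbit space is a Hausdorff smooth manifold and `M` is a principal
bundle over it, with the group `ℝ` or `ℝ / T ℤ` acting by the flow.) -/
structure IsRegularField {m : ℕ} {M : Type*} [TopologicalSpace M]
    [ChartedSpace (EuclideanSpace ℝ (Fin (m + 1))) M]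
    (ξ : ∀ x : M, TangentSpace (𝓡 (m + 1)) x) : Prop where
  complete : ∀ x : M, ∃ γ : ℝ → M, γ 0 = x ∧ IsMIntegralCurve (I := 𝓡 (m + 1)) γ ξ
  flowBox : ∀ p : M, ∃ e ∈ IsManifold.maximalAtlas (𝓡 (m + 1)) ∞ M, p ∈ e.source ∧ e p = 0 ∧
    (∃ a : ℝ, 0 < a ∧ e.target = {z | ∀ i, |z i| < a}) ∧
    (∀ x ∈ e.source, (mfderiv (𝓡 (m + 1)) (𝓡 (m + 1)) e x (ξ x) :
        EuclideanSpace ℝ (Fin (m + 1))) = EuclideanSpace.single 0 1) ∧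
    (∀ x ∈ e.source, ∀ y ∈ e.source, SameOrbit ξ x y → ∀ i, i ≠ 0 → e x i = e y i)
  hausdorff : T2Space (OrbitSpace ξ)

section Groups

variable {E : Type*} [NormedAddCommGroup E] [NormedSpace ℝ E]
  {M : Type*} [TopologicalSpace M] [ChartedSpace E M]

/-! ### The group of cosymplectomorphisms and its topology -/

/-- The smooth diffeomorphisms of `M`. -/
abbrev Diff (E : Type*) [NormedAddCommGroup E] [NormedSpace ℝ E]
    (M : Type*) [TopologicalSpace M] [ChartedSpace E M] : Type _ :=
  M ≃ₘ^∞⟮𝓘(ℝ, E), 𝓘(ℝ, E)⟯ M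

/-- Diffeomorphisms form a group under composition. -/
instance instGroupDiff : Group (Diff E M) where
  mul f g := g.trans f
  one := Diffeomorph.refl 𝓘(ℝ, E) M ∞
  inv f := f.symm
  mul_assoc _ _ _ := rfl
  one_mul _ := rfl
  mul_one _ := rfl
  inv_mul_cancel f := Diffeomorph.self_trans_symm f

/-- A subbasic neighbourhood of `f` for the `C^∞` compact-open topology: the `g` that map the
compact set `K` into the domain of the chart `e'` and whose expression in the charts `e`, `e'` is
`ε`-close to that of `f` on `K`, together with its derivatives up to order `r`. -/
def subbasicNhd (f : Diff E M) (e e' : OpenPartialHomeomorph M E) (K : Set M) (r : ℕ) (ε : ℝ) :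
    Set (Diff E M) :=
  {g | ∀ x ∈ K, g x ∈ e'.source ∧ ∀ k ≤ r,
    ‖iteratedFDeriv ℝ k (e' ∘ g ∘ e.symm) (e x) -
      iteratedFDeriv ℝ k (e' ∘ f ∘ e.symm) (e x)‖ < ε}

/-- The `C^∞` compact-open topology on the group of diffeomorphisms. -/
instance instTopologicalSpaceDiff : TopologicalSpace (Diff E M) :=
  TopologicalSpace.generateFrom
    {S | ∃ f : Diff E M, ∃ e ∈ IsManifold.maximalAtlas 𝓘(ℝ, E) ∞ M,
      ∃ e' ∈ IsManifold.maximalAtlas 𝓘(ℝ, E) ∞ M, ∃ (K : Set M) (r : ℕ) (ε : ℝ),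
        IsCompact K ∧ K ⊆ e.source ∧ MapsTo f K e'.source ∧ 0 < ε ∧
          S = subbasicNhd f e e' K r ε}

theorem pullback_id {k : ℕ} (Ω : DiffForm E M k) : pullback id Ω = Ω := by
  funext x
  simp only [pullback, mfderiv_id]
  rfl

theorem pullback_comp {k : ℕ} (f g : Diff E M) (Ω : DiffForm E M k) :
    pullback (f ∘ g) Ω = pullback g (pullback f Ω) := by
  funext x
  have h := mfderiv_comp (I := 𝓘(ℝ, E)) (I' := 𝓘(ℝ, E)) (I'' := 𝓘(ℝ, E)) x
    (f.mdifferentiable (by simp) (g x)) (g.mdifferentiable (by simp) x)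
  simp only [pullback, h]
  rfl

/-- The group of cosymplectomorphisms: diffeomorphisms `φ` with `φ^* η = η`, `φ^* Ω = Ω`. It
carries the subspace topology of the `C^∞` compact-open topology. -/
def Cosymp (η : DiffForm E M 1) (Ω : DiffForm E M 2) : Subgroup (Diff E M) where
  carrier := {φ | pullback φ η = η ∧ pullback φ Ω = Ω}
  one_mem' := ⟨pullback_id η, pullback_id Ω⟩
  mul_mem' {f g} hf hg := by
    refine ⟨?_, ?_⟩
    · exact (pullback_comp f g η).trans (by rw [hf.1, hg.1])
    · exact (pullback_comp f g Ω).trans (by rw [hf.2, hg.2])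
  inv_mem' {f} hf := by
    have key : ∀ {k : ℕ} (α : DiffForm E M k), pullback f α = α →
        pullback (f⁻¹ : Diff E M) α = α := by
      intro k α h
      have h1 := pullback_comp f f⁻¹ α
      have h2 : (f ∘ (f⁻¹ : Diff E M) : M → M) = id := by
        funext x
        exact f.apply_symm_apply x
      rw [h2, pullback_id, h] at h1
      exact h1.symm
    exact ⟨key η hf.1, key Ω hf.2⟩

/-- The identity component of the group of cosymplectomorphisms. -/
def Cosymp₀ (η : DiffForm E M 1) (Ω : DiffForm E M 2) : Set (Cosymp η Ω) :=
  connectedComponent 1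

/-- The centre of the identity component. -/
def centerCosymp₀ (η : DiffForm E M 1) (Ω : DiffForm E M 2) : Set (Cosymp η Ω) :=
  {g | g ∈ Cosymp₀ η Ω ∧ ∀ h ∈ Cosymp₀ η Ω, g * h = h * g}

end Groups

end Cosymplectic

end

open Cosymplectic

/-! Two opposite facts determine the centre.

Rigidity. In a flow box, a cosymplectomorphism mapping every Reeb orbit to itself has the form `z ↦
z + τ(z) e₀`. The form `η` is preserved, is invariant under translation along `e₀` and takes the
value `1` on `e₀`, so `dτ = 0`. Hence such a map is the identity near each fixed point, and on a
connected manifold one fixed point makes it the identity (`eventually_eq_of_preserves_orbits`,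
`eq_id_of_preserves_orbits`).

Flexibility. If `g x` is not on the orbit of `x`, some cosymplectic isotopy `f` moves `x` and is
supported near the orbit of `x`, away from `g x` (`exists_cosymp_isotopy`). A central `g` would then
satisfy `g (f x) = f (g x) = g x`, contradicting injectivity. So a central `g` preserves all orbits.
Writing `g x₀ = ψ_τ x₀` for one point `x₀`, rigidity applied to `ψ_{-τ} ∘ g` gives `g = ψ_τ`.
Conversely, the Reeb flow preserves both forms (`translation_invariant_of_closed`, a form of
Cartan's formula), is a smooth path from the identity, and commutes with every cosymplectomorphism
because these preserve `ξ` (`tderiv_reeb`).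

To build the isotopy, take a bump function of the transversal coordinates of a flow box and the
field `X` with `η(X) = 0` and `ι_X Ω = dh`. Its flow preserves both forms and commutes with
translations along `e₀` (`IsReebInvariant.exists_isotopy`), so it can be carried along orbits to a
saturated subset of `M`. This is well defined because all periodic orbits have the same periods,
which is rigidity applied to the maps `ψ_t`. Extension by the identity is smooth because the
saturation of a compact transversal ball is closed, and this is where the Hausdorff property of the
orbit space enters (`isClosed_saturatedBall`).

Two analytic facts support this: smooth dependence of flows on initial values, from the implicit
function theorem in `C([0,1], E)` (`contDiffAt_flow_of_zero`), and continuity of smooth families in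
the `C^∞` topology (`continuous_of_contMDiff_uncurry`), which places isotopies in the identity
component. -/

noncomputable section

namespace Cosymplectic

/-! ### Superposition operators on spaces of continuous functions -/

section Superposition

universe u
variable {K : Type*} [TopologicalSpace K] [CompactSpace K]
variable {E F : Type u} [NormedAddCommGroup E] [NormedSpace ℝ E] [NormedAddCommGroup F]
  [NormedSpace ℝ F]

/-- Pointwise evaluation of a continuous family of operators at a continuous family of vectors. -/
def pointwiseApply (K : Type*) [TopologicalSpace K] [CompactSpace K] (E F : Type*)
    [NormedAddCommGroup E] [NormedSpace ℝ E] [NormedAddCommGroup F] [NormedSpace ℝ F] :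
    C(K, E →L[ℝ] F) →L[ℝ] C(K, E) →L[ℝ] C(K, F) :=
  LinearMap.mkContinuous₂
    (LinearMap.mk₂ ℝ (fun (A : C(K, E →L[ℝ] F)) (h : C(K, E)) =>
        (⟨fun s => A s (h s), A.continuous.clm_apply h.continuous⟩ : C(K, F)))
      (fun A B h => by ext; simp) (fun c A h => by ext; simp)
      (fun A h k => by ext; simp) (fun c A h => by ext; simp)) 1
    (fun A h => by
      rw [one_mul, ContinuousMap.norm_le _ (by positivity)]
      intro s
      exact ((A s).le_opNorm (h s)).trans
        (by gcongr; exacts [A.norm_coe_le_norm s, h.norm_coe_le_norm s]))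

@[simp] theorem pointwiseApply_apply (A : C(K, E →L[ℝ] F)) (h : C(K, E)) (s : K) :
    pointwiseApply K E F A h s = A s (h s) := rfl

/-- The superposition operator `γ ↦ f ∘ γ`. -/
def superposition (K : Type*) [TopologicalSpace K] (f : C(E, F)) (γ : C(K, E)) : C(K, F) :=
  f.comp γ

/-- The mean value inequality at each parameter `s` gives an error at most `ε ‖h s‖`, and
compactness of the range of `γ` makes it uniform in `s`. -/
theorem hasFDerivAt_superposition (f : C(E, F)) (f' : C(E, E →L[ℝ] F))
    (hf : ∀ x, HasFDerivAt f (f' x) x) (γ : C(K, E)) :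
    HasFDerivAt (superposition K f) (pointwiseApply K E F (superposition K f' γ)) γ := by
  rw [hasFDerivAt_iff_isLittleO_nhds_zero, Asymptotics.isLittleO_iff]
  intro ε hε
  have hc : IsCompact (range γ) := isCompact_range γ.continuous
  -- One `δ` serves all base points in the compact range, while the nearby points may be anywhere in
  -- `E`; no local compactness is needed.
  have hu := hc.uniformContinuousAt_of_continuousAt f' (fun a _ => f'.continuous.continuousAt)
    (Metric.dist_mem_uniformity hε)
  obtain ⟨δ, hδ, hδ'⟩ := Metric.mem_uniformity_dist.1 hu
  filter_upwards [Metric.ball_mem_nhds (0 : C(K, E)) hδ] with h hh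
  rw [mem_ball_zero_iff] at hh
  rw [ContinuousMap.norm_le _ (by positivity)]
  intro s
  have hs : ‖h s‖ < δ := (h.norm_coe_le_norm s).trans_lt hh
  have key := Convex.norm_image_sub_le_of_norm_hasFDerivWithin_le' (f := f) (f' := f')
    (s := Metric.ball (γ s) δ) (x := γ s) (y := γ s + h s) (C := ε) (φ := f' (γ s))
    (fun x _ => (hf x).hasFDerivWithinAt)
    (fun x hx => by
      have := hδ' (a := γ s) (b := x) (by rw [dist_comm]; exact hx) (mem_range_self s)
      rw [← dist_eq_norm, dist_comm]
      exact this.le)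
    (convex_ball _ _) (Metric.mem_ball_self hδ) (by simpa [Metric.mem_ball, dist_eq_norm] using hs)
  simp only [add_sub_cancel_left] at key
  refine le_trans ?_ (key.trans (mul_le_mul_of_nonneg_left (h.norm_coe_le_norm s) hε.le))
  exact le_rfl

/-- The derivative is again a superposition operator, that of `fderiv ℝ f`, followed by a continuous
linear map. The induction therefore changes the target to `E →L[ℝ] F`, which is why `F` is
quantified inside and shares the universe of `E`. -/
theorem contDiff_superposition_nat (n : ℕ) : ∀ {F : Type u} [NormedAddCommGroup F]
    [NormedSpace ℝ F] (f : C(E, F)), ContDiff ℝ ∞ f → ContDiff ℝ n (superposition K f) := by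
  induction n with
  | zero =>
    intro F _ _ f _
    rw [Nat.cast_zero, contDiff_zero]
    exact ContinuousMap.continuous_postcomp f
  | succ n ih =>
    intro F _ _ f hf
    rw [Nat.cast_succ, contDiff_succ_iff_hasFDerivAt]
    let f' : C(E, E →L[ℝ] F) := ⟨fderiv ℝ f, hf.continuous_fderiv (by simp)⟩
    refine ⟨fun γ => pointwiseApply K E F (superposition K f' γ), ?_, ?_⟩
    · exact (pointwiseApply K E F).contDiff.comp
        (ih f' (hf.fderiv_right (m := ∞) (by simp)))
    · exact hasFDerivAt_superposition f f'
        (fun x => (hf.differentiable (by simp) x).hasFDerivAt)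

theorem contDiff_superposition (f : C(E, F)) (hf : ContDiff ℝ ∞ f) :
    ContDiff ℝ ∞ (superposition K f) :=
  contDiff_infty.2 fun n => contDiff_superposition_nat n f hf

end Superposition

/-! ### One-parameter groups that are smooth for small times -/

section OneParameterGroup

variable {E : Type*} [NormedAddCommGroup E] [NormedSpace ℝ E]
  {M : Type*} [TopologicalSpace M] [ChartedSpace E M]

/-- For fixed `p`, the times `t` with smoothness near `(t, p)` form an open set. It is also closed:
for a limit `s`, choose such an `r` close to `s` and write `ψ_t = ψ_{t-r} ∘ ψ_r`, where the first
factor involves only small times near `ψ_s p`. -/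
theorem contMDiff_of_oneParameterGroup {n : ℕ∞ω} (ψ : ℝ → M → M)
    (hadd : ∀ s t x, ψ (s + t) x = ψ s (ψ t x))
    (hcont : ∀ x, Continuous fun t => ψ t x)
    (hloc : ∀ p, ∀ᶠ q in 𝓝 ((0 : ℝ), p),
      ContMDiffAt (𝓘(ℝ, ℝ).prod 𝓘(ℝ, E)) 𝓘(ℝ, E) n (Function.uncurry ψ) q) :
    ContMDiff (𝓘(ℝ, ℝ).prod 𝓘(ℝ, E)) 𝓘(ℝ, E) n (Function.uncurry ψ) := by
  rintro ⟨t, p⟩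
  let J : Set ℝ := {t | ∀ᶠ q in 𝓝 (t, p),
    ContMDiffAt (𝓘(ℝ, ℝ).prod 𝓘(ℝ, E)) 𝓘(ℝ, E) n (Function.uncurry ψ) q}
  have hopen : IsOpen J := by
    rw [isOpen_iff_mem_nhds]
    intro s hs
    have h1 : ∀ᶠ s' in 𝓝 s, ∀ᶠ q in 𝓝 (s', p),
        ContMDiffAt (𝓘(ℝ, ℝ).prod 𝓘(ℝ, E)) 𝓘(ℝ, E) n (Function.uncurry ψ) q :=
      (Continuous.prodMk_left p).continuousAt.eventually hs.eventually_nhds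
    exact h1
  have hclosed : closure J ∩ univ ⊆ J := by
    rintro s ⟨hs, -⟩
    have h1 := (hloc (ψ s p)).eventually_nhds
    have h2 : Filter.Tendsto (fun r : ℝ => (s - r, ψ r p)) (𝓝 s) (𝓝 (0, ψ s p)) := by
      have : Continuous fun r : ℝ => (s - r, ψ r p) := by
        have := hcont p
        fun_prop
      simpa using this.tendsto s
    obtain ⟨r, hr, hrJ⟩ := mem_closure_iff_nhds.1 hs _ (h2.eventually h1)
    replace hr : ∀ᶠ q in 𝓝 (s - r, ψ r p),
      ContMDiffAt (𝓘(ℝ, ℝ).prod 𝓘(ℝ, E)) 𝓘(ℝ, E) n (Function.uncurry ψ) q := hr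
    replace hrJ : ∀ᶠ q in 𝓝 (r, p),
      ContMDiffAt (𝓘(ℝ, ℝ).prod 𝓘(ℝ, E)) 𝓘(ℝ, E) n (Function.uncurry ψ) q := hrJ
    have hx : ∀ᶠ x in 𝓝 p, ContMDiffAt (𝓘(ℝ, ℝ).prod 𝓘(ℝ, E)) 𝓘(ℝ, E) n
        (Function.uncurry ψ) (r, x) :=
      (Continuous.prodMk_right r).continuousAt.eventually hrJ
    have hcp : ContinuousAt (fun q : ℝ × M => (q.1 - r, ψ r q.2)) (s, p) := by
      have : ContinuousAt (fun q : ℝ × M => Function.uncurry ψ (r, q.2)) (s, p) :=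
        ContinuousAt.comp (f := fun q : ℝ × M => (r, q.2)) (x := (s, p)) (g := Function.uncurry ψ)
          hrJ.self_of_nhds.continuousAt (by fun_prop)
      exact ContinuousAt.prodMk (by fun_prop) this
    have hsnd : ∀ᶠ q : ℝ × M in 𝓝 (s, p), ContMDiffAt (𝓘(ℝ, ℝ).prod 𝓘(ℝ, E)) 𝓘(ℝ, E) n
        (Function.uncurry ψ) (r, q.2) := (continuous_snd.tendsto (s, p)).eventually hx
    filter_upwards [hcp.eventually hr, hsnd] with q hq1 hq2
    have heq : Function.uncurry ψ = fun q : ℝ × M => Function.uncurry ψ (q.1 - r, ψ r q.2) := by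
      funext q
      simp [Function.uncurry, ← hadd]
    rw [heq]
    refine ContMDiffAt.comp (g := Function.uncurry ψ) (f := fun q : ℝ × M => (q.1 - r, ψ r q.2))
      q hq1 ?_
    refine ContMDiffAt.prodMk ?_ ?_
    · exact contMDiffAt_fst.sub contMDiffAt_const
    · exact ContMDiffAt.comp (g := Function.uncurry ψ) (f := fun q : ℝ × M => (r, q.2)) q hq2
        (contMDiffAt_const.prodMk contMDiffAt_snd)
  have hall : univ ⊆ J := isPreconnected_univ.subset_of_closure_inter_subset hopen
    ⟨0, mem_univ _, hloc p⟩ hclosed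
  exact (hall (mem_univ t)).self_of_nhds

end OneParameterGroup

/-! ### The flow of a smooth, bounded, Lipschitz vector field on a Banach space -/

section SmoothFlow

universe u
variable {E : Type u} [NormedAddCommGroup E] [NormedSpace ℝ E]

/-- The continuous extension to `ℝ` of a function on the unit interval. -/
abbrev extendUnit {E : Type*} [NormedAddCommGroup E] (γ : C(unitInterval, E)) (r : ℝ) : E := γ (projIcc 0 1 zero_le_one r)

theorem continuous_extendUnit {E : Type*} [NormedAddCommGroup E] (γ : C(unitInterval, E)) : Continuous (extendUnit γ) :=
  γ.continuous.comp continuous_projIcc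

/-- The operator of integration from `0`. -/
def volterra (E : Type u) [NormedAddCommGroup E] [NormedSpace ℝ E] :
    C(unitInterval, E) →L[ℝ] C(unitInterval, E) :=
  LinearMap.mkContinuous
    { toFun := fun γ => ⟨fun s => ∫ r in (0 : ℝ)..s, extendUnit γ r, by
        have := intervalIntegral.continuous_primitive (μ := MeasureTheory.volume)
          (fun a b => (continuous_extendUnit γ).intervalIntegrable a b) 0
        exact this.comp continuous_subtype_val⟩
      map_add' := fun γ δ => by
        ext s
        exact intervalIntegral.integral_add ((continuous_extendUnit γ).intervalIntegrable _ _)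
          ((continuous_extendUnit δ).intervalIntegrable _ _)
      map_smul' := fun c γ => by
        ext s
        exact intervalIntegral.integral_smul c _ } 1
    (fun γ => by
      rw [one_mul, ContinuousMap.norm_le _ (norm_nonneg _)]
      intro s
      have h := intervalIntegral.norm_integral_le_of_norm_le_const (a := 0) (b := (s : ℝ))
        (f := extendUnit γ) (C := ‖γ‖) (fun r _ => γ.norm_coe_le_norm _)
      refine h.trans ?_
      rw [sub_zero, abs_of_nonneg s.2.1]
      exact mul_le_of_le_one_right (norm_nonneg _) s.2.2)

theorem volterra_apply (γ : C(unitInterval, E)) (s : unitInterval) :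
    volterra E γ s = ∫ r in (0 : ℝ)..s, extendUnit γ r := rfl

/-- The equation satisfied by the integral curve `s ↦ γ s` of `t • X` with `γ 0 = x`. -/
def integralEquation (X : C(E, E)) (q : (ℝ × E) × C(unitInterval, E)) : C(unitInterval, E) :=
  q.2 - ContinuousMap.const _ q.1.2 - q.1.1 • volterra E (superposition unitInterval X q.2)

theorem contDiff_integralEquation (X : C(E, E)) (hX : ContDiff ℝ ∞ X) :
    ContDiff ℝ ∞ (integralEquation X) := by
  have h1 : ContDiff ℝ ∞ fun q : (ℝ × E) × C(unitInterval, E) =>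
      (ContinuousMap.const unitInterval q.1.2 : C(unitInterval, E)) := by
    have : ContDiff ℝ ∞ fun x : E => (ContinuousMap.const unitInterval x : C(unitInterval, E)) :=
      (ContinuousLinearMap.const ℝ unitInterval : E →L[ℝ] C(unitInterval, E)).contDiff
    exact this.comp (contDiff_snd.comp contDiff_fst)
  have h2 : ContDiff ℝ ∞ fun q : (ℝ × E) × C(unitInterval, E) =>
      volterra E (superposition unitInterval X q.2) :=
    (volterra E).contDiff.comp ((contDiff_superposition X hX).comp contDiff_snd)
  exact (contDiff_snd.sub h1).sub ((contDiff_fst.comp contDiff_fst).smul h2)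

/-- At time `0` the equation reads `γ - x = 0`, so its partial derivative in `γ` is the identity.
This is the invertibility required by the implicit function theorem. -/
theorem fderiv_integralEquation_comp_inr (X : C(E, E)) (hX : ContDiff ℝ ∞ X) (x : E)
    (γ : C(unitInterval, E)) :
    (fderiv ℝ (integralEquation X) ((0, x), γ)).comp
      (.inr ℝ (ℝ × E) C(unitInterval, E)) = .id ℝ _ := by
  have h1 : HasFDerivAt (integralEquation X)
      (fderiv ℝ (integralEquation X) ((0, x), γ)) ((0, x), γ) :=
    ((contDiff_integralEquation X hX).differentiable (by simp) _).hasFDerivAt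
  have h2 : HasFDerivAt (fun δ : C(unitInterval, E) => (((0 : ℝ), x), δ))
      (.inr ℝ (ℝ × E) C(unitInterval, E)) γ := hasFDerivAt_prodMk_right _ _
  have h3 := h1.comp γ h2
  have h4 : (integralEquation X ∘ fun δ : C(unitInterval, E) => (((0 : ℝ), x), δ)) =
      fun δ => δ - ContinuousMap.const _ x := by
    funext δ
    simp [integralEquation]
  rw [h4] at h3
  exact h3.unique ((hasFDerivAt_id γ).sub_const _)

theorem hasDerivAt_of_integralEquation_eq_zero [CompleteSpace E] (X : C(E, E)) (t : ℝ) (x : E)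
    (γ : C(unitInterval, E)) (h : integralEquation X ((t, x), γ) = 0) :
    extendUnit γ 0 = x ∧ ∀ s ∈ Icc (0 : ℝ) 1,
      HasDerivWithinAt (extendUnit γ) (t • X (extendUnit γ s)) (Icc 0 1) s := by
  have heq : ∀ s ∈ Icc (0 : ℝ) 1, extendUnit γ s =
      x + t • ∫ r in (0 : ℝ)..s, X (extendUnit γ r) := by
    intro s hs
    have := congrArg (fun δ : C(unitInterval, E) => δ ⟨s, hs⟩) h
    simp only [integralEquation, ContinuousMap.sub_apply, ContinuousMap.const_apply,
      ContinuousMap.smul_apply, volterra_apply, ContinuousMap.zero_apply] at this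
    rw [extendUnit, projIcc_of_mem zero_le_one hs]
    rw [sub_sub, sub_eq_zero] at this
    exact this
  refine ⟨by simpa using heq 0 (by simp), fun s hs => ?_⟩
  have hc : Continuous fun r => X (extendUnit γ r) := X.continuous.comp (continuous_extendUnit γ)
  have hd : HasDerivAt (fun s => x + t • ∫ r in (0 : ℝ)..s, X (extendUnit γ r))
      (t • X (extendUnit γ s)) s :=
    ((intervalIntegral.integral_hasDerivAt_right (hc.intervalIntegrable _ _)
      (hc.stronglyMeasurableAtFilter _ _) hc.continuousAt).const_smul t).const_add x
  exact hd.hasDerivWithinAt.congr heq (heq s hs)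

/-- A bounded Lipschitz vector field has global integral curves. -/
theorem exists_forall_hasDerivAt [CompleteSpace E] {X : E → E} {K C : NNReal}
    (hL : LipschitzWith K X) (hC : ∀ x, ‖X x‖ ≤ C) (x : E) :
    ∃ γ : ℝ → E, γ 0 = x ∧ ∀ t, HasDerivAt γ (X (γ t)) t := by
  have hloc : ∀ T : ℝ, 0 < T → ∃ γ : ℝ → E, γ 0 = x ∧
      ∀ t ∈ Ioo (-T) T, HasDerivAt γ (X (γ t)) t := by
    intro T hT
    -- A field bounded by `C` moves a point by at most `C T` in time `T`, so the ball of radius `C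
    -- T` suffices for every `T`.
    have hp : IsPicardLindelof (fun _ => X) (tmin := -T) (tmax := T)
        ⟨0, by constructor <;> linarith⟩ x (C * ⟨T, hT.le⟩) 0 C K :=
      { lipschitzOnWith := fun t _ => hL.lipschitzOnWith
        continuousOn := fun _ _ => continuousOn_const
        norm_le := fun t _ y _ => hC y
        mul_max_le := by
          simp only [sub_zero, sub_neg_eq_add, zero_add, max_self, NNReal.coe_zero]
          exact le_rfl }
    obtain ⟨γ, hγ0, hγ⟩ := hp.exists_eq_forall_mem_Icc_hasDerivWithinAt₀
    exact ⟨γ, hγ0, fun t ht => (hγ t (Ioo_subset_Icc_self ht)).hasDerivAt (Icc_mem_nhds ht.1 ht.2)⟩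
  choose! γ hγ0 hγ using hloc
  have hagree : ∀ S T : ℝ, 0 < S → S ≤ T → EqOn (γ S) (γ T) (Ioo (-S) S) := by
    intro S T hS hST
    refine ODE_solution_unique_of_mem_Ioo (v := fun _ => X) (s := fun _ => univ) (K := K)
      (t₀ := 0) (fun _ _ => hL.lipschitzOnWith) ⟨by linarith, hS⟩
      (fun t ht => ⟨hγ S hS t ht, mem_univ _⟩)
      (fun t ht => ⟨hγ T (hS.trans_le hST) t ⟨by linarith [ht.1], by linarith [ht.2]⟩,
        mem_univ _⟩) ?_
    rw [hγ0 S hS, hγ0 T (hS.trans_le hST)]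
  -- The local solutions agree where they overlap; at time `t` the one on `(-(|t| + 1), |t| + 1)` is
  -- used, which has `t` in its interior.
  refine ⟨fun t => γ (|t| + 1) t, hγ0 _ (by positivity), fun t => ?_⟩
  have ht : t ∈ Ioo (-(|t| + 1)) (|t| + 1) := by
    constructor <;> linarith [neg_abs_le t, le_abs_self t]
  have hpos : 0 < |t| + 1 := by positivity
  refine (hγ _ hpos t ht).congr_of_eventuallyEq ?_
  filter_upwards [isOpen_Ioo.mem_nhds ht] with s hs
  have hs' : |s| < |t| + 1 := abs_lt.2 hs
  have hmem : s ∈ Ioo (-(|s| + 1)) (|s| + 1) := by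
    constructor <;> linarith [neg_abs_le s, le_abs_self s]
  rcases le_total (|s| + 1) (|t| + 1) with h | h
  · exact hagree _ _ (by positivity) h hmem
  · exact (hagree _ _ hpos h hs).symm

/-- Rescaling time turns the orbit of `x` up to time `t` into a curve on `[0, 1]` solving `γ = x + t
∫ X ∘ γ`. The implicit function theorem gives a solution in `C([0,1], E)` depending smoothly on `(t,
x)`; by uniqueness it is `s ↦ Φ (t s) x`, and its value at `1` is the flow. -/
theorem contDiffAt_flow_of_zero [CompleteSpace E] {X : E → E} {K : NNReal}
    (hX : ContDiff ℝ ∞ X) (hL : LipschitzWith K X) (Φ : ℝ → E → E) (h0 : ∀ x, Φ 0 x = x)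
    (hΦ : ∀ x t, HasDerivAt (fun t => Φ t x) (X (Φ t x)) t) (x₀ : E) :
    ContDiffAt ℝ ∞ (Function.uncurry Φ) (0, x₀) := by
  let X' : C(E, E) := ⟨X, hX.continuous⟩
  let u : (ℝ × E) × C(unitInterval, E) := ((0, x₀), ContinuousMap.const _ x₀)
  have hF : ContDiffAt ℝ ∞ (integralEquation X') u := (contDiff_integralEquation X' hX).contDiffAt
  have hinv : ((fderiv ℝ (integralEquation X') u).comp
      (.inr ℝ (ℝ × E) C(unitInterval, E))).IsInvertible := by
    rw [fderiv_integralEquation_comp_inr X' hX]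
    exact ⟨ContinuousLinearEquiv.refl ℝ _, rfl⟩
  have hu : integralEquation X' u = 0 := by simp [integralEquation, u]
  have hne : (∞ : ℕ∞ω) ≠ 0 := by simp
  have hg := hF.contDiffAt_implicitFunction hne hinv
  have hev := hF.eventually_apply_implicitFunction hne hinv
  set g := hF.implicitFunction hne hinv
  have hev1 : ContDiffAt ℝ ∞ (fun q : ℝ × E => g q 1) (0, x₀) :=
    (ContinuousMap.evalCLM ℝ (1 : unitInterval) : C(unitInterval, E) →L[ℝ] E).contDiff.contDiffAt.comp
      (0, x₀) hg
  refine hev1.congr_of_eventuallyEq ?_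
  filter_upwards [hev] with q hq
  rw [hu] at hq
  obtain ⟨t, x⟩ := q
  obtain ⟨hi, hd⟩ := hasDerivAt_of_integralEquation_eq_zero X' t x _ hq
  have hv : LipschitzWith (‖t‖₊ * K) fun y => t • X y := (lipschitzWith_smul t).comp hL
  have hΦ' : ∀ s, HasDerivAt (fun s => Φ (t * s) x) (t • X (Φ (t * s) x)) s := by
    intro s
    have := (hΦ x (t * s)).scomp s ((hasDerivAt_id s).const_mul t)
    simpa [Function.comp_def] using this
  have heq := ODE_solution_unique (v := fun _ y => t • X y) (a := 0) (b := 1)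
    (f := fun s => Φ (t * s) x) (g := extendUnit (g (t, x))) (fun _ => hv)
    (fun s _ => (hΦ' s).continuousAt.continuousWithinAt)
    (fun s _ => (hΦ' s).hasDerivWithinAt)
    (continuous_extendUnit _).continuousOn
    (fun s hs => (hd s (Ico_subset_Icc_self hs)).mono_of_mem_nhdsWithin
      (Icc_mem_nhdsGE_of_mem hs))
    (by rw [hi]; simp [h0])
  have h1 := heq (right_mem_Icc.2 zero_le_one)
  simpa [extendUnit] using h1

/-- The flow of a smooth, bounded, Lipschitz vector field exists for all times and is smooth. -/
theorem exists_smooth_flow [CompleteSpace E] {X : E → E} {K C : NNReal}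
    (hX : ContDiff ℝ ∞ X) (hL : LipschitzWith K X) (hC : ∀ x, ‖X x‖ ≤ C) :
    ∃ Φ : ℝ → E → E, (∀ x, Φ 0 x = x) ∧ (∀ s t x, Φ (s + t) x = Φ s (Φ t x)) ∧
      (∀ x t, HasDerivAt (fun t => Φ t x) (X (Φ t x)) t) ∧
      ContDiff ℝ ∞ (Function.uncurry Φ) := by
  choose γ hγ0 hγ using exists_forall_hasDerivAt hL hC
  have hadd : ∀ s t x, γ x (s + t) = γ (γ x t) s := by
    intro s t x
    have := ODE_solution_unique_univ (v := fun _ => X) (s := fun _ => univ) (K := K)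
      (f := fun s => γ x (s + t)) (g := fun s => γ (γ x t) s) (t₀ := 0)
      (fun _ => hL.lipschitzOnWith)
      (fun s => ⟨by simpa using (hγ x (s + t)).comp_add_const s t, mem_univ _⟩)
      (fun s => ⟨hγ _ s, mem_univ _⟩) (by simp [hγ0])
    exact congrFun this s
  refine ⟨fun t x => γ x t, hγ0, hadd, hγ, contDiff_infty.2 fun n => ?_⟩
  have hloc := contDiffAt_flow_of_zero hX hL (fun t x => γ x t) hγ0 hγ
  have := contMDiff_of_oneParameterGroup (E := E) (M := E) (n := n) (fun t x => γ x t) hadd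
    (fun x => continuous_iff_continuousAt.2 fun t => (hγ x t).continuousAt)
    (fun p => by
      have h1 := ((hloc p).of_le (m := n) (mod_cast le_top)).eventually (by simp)
      filter_upwards [h1] with q hq
      rw [← modelWithCornersSelf_prod, chartedSpaceSelf_prod]
      exact hq.contMDiffAt)
  rw [← modelWithCornersSelf_prod, chartedSpaceSelf_prod] at this
  exact this.contDiff

end SmoothFlow

/-! ### Smooth families of diffeomorphisms are continuous in the `C^∞` topology -/

section SmoothFamilies

variable {E : Type*} [NormedAddCommGroup E] [NormedSpace ℝ E]

theorem contDiffOn_fderiv_snd {F : Type*} [NormedAddCommGroup F] [NormedSpace ℝ F]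
    {H : ℝ × E → F} {W : Set (ℝ × E)} (hW : IsOpen W) (hH : ContDiffOn ℝ ∞ H W) :
    ContDiffOn ℝ ∞ (fun q : ℝ × E => fderiv ℝ (fun y => H (q.1, y)) q.2) W := by
  have h1 : ContDiffOn ℝ ∞ (fun q => (fderiv ℝ H q).comp (.inr ℝ ℝ E)) W :=
    (hH.fderiv_of_isOpen hW (m := ∞) (by simp)).clm_comp contDiffOn_const
  refine h1.congr fun q hq => ?_
  have hd : HasFDerivAt H (fderiv ℝ H q) (q.1, q.2) :=
    ((hH.contDiffAt (hW.mem_nhds hq)).differentiableAt (by simp)).hasFDerivAt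
  exact (hd.comp q.2 (hasFDerivAt_prodMk_right q.1 q.2)).fderiv

theorem contDiffOn_iteratedFDeriv_snd {F : Type*} [NormedAddCommGroup F] [NormedSpace ℝ F]
    {H : ℝ × E → F} {W : Set (ℝ × E)} (hW : IsOpen W) (hH : ContDiffOn ℝ ∞ H W) (k : ℕ) :
    ContDiffOn ℝ ∞ (fun q : ℝ × E => iteratedFDeriv ℝ k (fun y => H (q.1, y)) q.2) W := by
  induction k with
  | zero =>
    simp only [iteratedFDeriv_zero_eq_comp, Function.comp_def]
    exact (continuousMultilinearCurryFin0 ℝ E F).symm.contDiff.comp_contDiffOn hH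
  | succ k ih =>
    simp only [iteratedFDeriv_succ_eq_comp_left, Function.comp_def]
    exact (continuousMultilinearCurryLeftEquiv ℝ (fun _ : Fin (k + 1) => E)
      F).symm.contDiff.comp_contDiffOn (contDiffOn_fderiv_snd hW ih)

variable {M : Type*} [TopologicalSpace M] [ChartedSpace E M]

/-- The model on `ℝ × M`. -/
local notation "𝓙" => ModelWithCorners.prod 𝓘(ℝ, ℝ) 𝓘(ℝ, E)

theorem contDiffOn_localExpression {F : ℝ × M → M} (hF : ContMDiff 𝓙 𝓘(ℝ, E) ∞ F)
    {e e' : OpenPartialHomeomorph M E} (he : e ∈ IsManifold.maximalAtlas 𝓘(ℝ, E) ∞ M)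
    (he' : e' ∈ IsManifold.maximalAtlas 𝓘(ℝ, E) ∞ M) :
    IsOpen {q : ℝ × E | q.2 ∈ e.target ∧ F (q.1, e.symm q.2) ∈ e'.source} ∧
      ContDiffOn ℝ ∞ (fun q : ℝ × E => e' (F (q.1, e.symm q.2)))
        {q | q.2 ∈ e.target ∧ F (q.1, e.symm q.2) ∈ e'.source} := by
  have h1 : ContMDiffOn (𝓘(ℝ, ℝ).prod 𝓘(ℝ, E)) 𝓘(ℝ, E) ∞
      (fun q : ℝ × E => F (q.1, e.symm q.2)) {q | q.2 ∈ e.target} := by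
    refine hF.comp_contMDiffOn (contMDiffOn_fst.prodMk ?_)
    exact (contMDiffOn_symm_of_mem_maximalAtlas he).comp contMDiffOn_snd fun q hq => hq
  have hopen : IsOpen {q : ℝ × E | q.2 ∈ e.target ∧ F (q.1, e.symm q.2) ∈ e'.source} :=
    h1.continuousOn.isOpen_inter_preimage (e.open_target.preimage continuous_snd) e'.open_source
  refine ⟨hopen, ?_⟩
  have h2 : ContMDiffOn (𝓘(ℝ, ℝ).prod 𝓘(ℝ, E)) 𝓘(ℝ, E) ∞
      (fun q : ℝ × E => e' (F (q.1, e.symm q.2)))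
      {q | q.2 ∈ e.target ∧ F (q.1, e.symm q.2) ∈ e'.source} :=
    (contMDiffOn_of_mem_maximalAtlas he').comp (h1.mono fun q hq => hq.1) fun q hq => hq.2
  rw [← modelWithCornersSelf_prod, chartedSpaceSelf_prod] at h2
  exact h2.contDiffOn

/-- The derivatives in the space variable are jointly continuous in `(t, x)`, so the strict
inequalities defining a subbasic set persist near each `(t, x)`; compactness of `K` gives one
neighbourhood of `t`. -/
theorem continuous_of_contMDiff_uncurry (f : ℝ → Diff E M)
    (hf : ContMDiff 𝓙 𝓘(ℝ, E) ∞ (fun q : ℝ × M => f q.1 q.2)) : Continuous f := by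
  rw [continuous_generateFrom_iff]
  rintro S ⟨g, e, he, e', he', K, r, ε, hK, hKe, hgK, hε, rfl⟩
  rw [isOpen_iff_mem_nhds]
  intro t ht
  obtain ⟨hWo, hW⟩ := contDiffOn_localExpression hf he he'
  set W := {q : ℝ × E | q.2 ∈ e.target ∧ f q.1 (e.symm q.2) ∈ e'.source} with hWdef
  -- The centre `g` is treated as a constant family, so that its derivatives are continuous near the
  -- same points.
  have hg : ContMDiff 𝓙 𝓘(ℝ, E) ∞ (fun q : ℝ × M => g q.2) := g.contMDiff.comp contMDiff_snd
  obtain ⟨hVo, hV⟩ := contDiffOn_localExpression hg he he'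
  set V := {q : ℝ × E | q.2 ∈ e.target ∧ g (e.symm q.2) ∈ e'.source} with hVdef
  refine hK.eventually_forall_of_forall_eventually fun x hx => ?_
  have hxe := hKe hx
  obtain ⟨hx1, hx2⟩ := ht x hx
  have hxt : e x ∈ e.target := e.map_source hxe
  have hcont : ContinuousAt (fun q : ℝ × M => (q.1, e q.2)) (t, x) :=
    continuousAt_fst.prodMk ((e.continuousAt hxe).comp continuousAt_snd)
  have hmemW : (t, e x) ∈ W := ⟨hxt, by simpa [e.left_inv hxe] using hx1⟩
  have hmemV : (t, e x) ∈ V := ⟨hxt, by simpa [e.left_inv hxe] using hgK hx⟩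
  have hev1 : ∀ᶠ q : ℝ × M in 𝓝 (t, x), f q.1 q.2 ∈ e'.source :=
    hf.continuous.continuousAt.eventually (e'.open_source.mem_nhds hx1)
  have hev2 : ∀ k ∈ Finset.range (r + 1), ∀ᶠ q : ℝ × M in 𝓝 (t, x),
      ‖iteratedFDeriv ℝ k (e' ∘ f q.1 ∘ e.symm) (e q.2) -
        iteratedFDeriv ℝ k (e' ∘ g ∘ e.symm) (e q.2)‖ < ε := by
    intro k hk
    have h1 : ContinuousAt (fun q : ℝ × E =>
        iteratedFDeriv ℝ k (fun y => e' (f q.1 (e.symm y))) q.2) (t, e x) :=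
      (contDiffOn_iteratedFDeriv_snd hWo hW k).continuousOn.continuousAt (hWo.mem_nhds hmemW)
    have h2 : ContinuousAt (fun q : ℝ × E =>
        iteratedFDeriv ℝ k (fun y => e' (g (e.symm y))) q.2) (t, e x) :=
      (contDiffOn_iteratedFDeriv_snd hVo hV k).continuousOn.continuousAt (hVo.mem_nhds hmemV)
    have h3 := (ContinuousAt.comp (f := fun q : ℝ × M => (q.1, e q.2)) (x := (t, x))
      (h1.sub h2) hcont).norm
    exact h3.eventually (gt_mem_nhds (hx2 k (Finset.mem_range_succ_iff.1 hk)))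
  have hev3 := (Finset.eventually_all (Finset.range (r + 1))).2 hev2
  filter_upwards [hev1, hev3] with q hq1 hq2
  exact ⟨hq1, fun k hk => hq2 k (Finset.mem_range_succ_iff.2 hk)⟩

theorem mem_cosymp₀_of_smooth_family {η : DiffForm E M 1} {Ω : DiffForm E M 2}
    (f : ℝ → Cosymp η Ω) (h0 : f 0 = 1)
    (hf : ContMDiff 𝓙 𝓘(ℝ, E) ∞ (fun q : ℝ × M => (f q.1).1 q.2)) (t : ℝ) :
    f t ∈ Cosymp₀ η Ω := by
  have hc : Continuous f :=
    continuous_induced_rng.2 (continuous_of_contMDiff_uncurry (fun t => (f t).1) hf)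
  exact (isPreconnected_range hc).subset_connectedComponent ⟨0, h0⟩ (mem_range_self t)

end SmoothFamilies

/-! ### Vector fields that can be straightened -/

section Straightening

variable {E : Type*} [NormedAddCommGroup E] [NormedSpace ℝ E]
  {M : Type*} [TopologicalSpace M] [ChartedSpace E M]

/-- The chart `e` has convex image and maps the vector field `ξ` to the constant field `e₀`. -/
structure Straightens (e : OpenPartialHomeomorph M E) (ξ : ∀ x : M, TangentSpace 𝓘(ℝ, E) x)
    (e₀ : E) : Prop where
  mem_atlas : e ∈ IsManifold.maximalAtlas 𝓘(ℝ, E) ∞ M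
  convex : Convex ℝ e.target
  map_field : ∀ x ∈ e.source, (mfderiv 𝓘(ℝ, E) 𝓘(ℝ, E) e x (ξ x) : E) = e₀

variable {ξ : ∀ x : M, TangentSpace 𝓘(ℝ, E) x} {e₀ : E} {e : OpenPartialHomeomorph M E}

theorem mdifferentiableAt_of_mem_maximalAtlas (he : e ∈ IsManifold.maximalAtlas 𝓘(ℝ, E) ∞ M)
    {x : M} (hx : x ∈ e.source) : MDifferentiableAt 𝓘(ℝ, E) 𝓘(ℝ, E) e x :=
  ((contMDiffOn_of_mem_maximalAtlas he).contMDiffAt (e.open_source.mem_nhds hx)).mdifferentiableAt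
    (by simp)

theorem mdifferentiableAt_symm_of_mem_maximalAtlas
    (he : e ∈ IsManifold.maximalAtlas 𝓘(ℝ, E) ∞ M) {y : E} (hy : y ∈ e.target) :
    MDifferentiableAt 𝓘(ℝ, E) 𝓘(ℝ, E) e.symm y :=
  ((contMDiffOn_symm_of_mem_maximalAtlas he).contMDiffAt
    (e.open_target.mem_nhds hy)).mdifferentiableAt (by simp)

theorem Straightens.hasDerivAt_comp (he : Straightens e ξ e₀) {γ : ℝ → M}
    (hγ : IsMIntegralCurve (I := 𝓘(ℝ, E)) γ ξ) {t : ℝ} (ht : γ t ∈ e.source) :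
    HasDerivAt (fun t => e (γ t)) e₀ t := by
  have h1 := (mdifferentiableAt_of_mem_maximalAtlas he.mem_atlas ht).hasMFDerivAt
  have h2 := HasMFDerivAt.comp t h1 (hγ t)
  rw [hasDerivAt_iff_hasFDerivAt]
  refine h2.hasFDerivAt.congr_fderiv ?_
  rw [← he.map_field _ ht]
  refine ContinuousLinearMap.ext fun r => ?_
  exact (mfderiv 𝓘(ℝ, E) 𝓘(ℝ, E) e (γ t)).map_smul r (ξ (γ t))

theorem Straightens.eventually_eq (he : Straightens e ξ e₀) {γ : ℝ → M}
    (hγ : IsMIntegralCurve (I := 𝓘(ℝ, E)) γ ξ) {s : ℝ} (hs : γ s ∈ e.source) :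
    ∀ᶠ t in 𝓝 s, γ t ∈ e.source ∧ e (γ t) = e (γ s) + (t - s) • e₀ := by
  have h1 : ∀ᶠ t in 𝓝 s, γ t ∈ e.source :=
    hγ.continuous.continuousAt.eventually (e.open_source.mem_nhds hs)
  obtain ⟨ε, hε, hball⟩ := Metric.eventually_nhds_iff_ball.1 h1
  filter_upwards [Metric.ball_mem_nhds s hε] with t ht
  refine ⟨hball t ht, ?_⟩
  have hd : ∀ u ∈ Metric.ball s ε,
      HasDerivWithinAt (fun u => e (γ u) - (u - s) • e₀) 0 (Metric.ball s ε) u := by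
    intro u hu
    have h2 := (he.hasDerivAt_comp hγ (hball u hu)).sub
      (((hasDerivAt_id u).sub_const s).smul_const e₀)
    simp only [one_smul, sub_self] at h2
    exact h2.hasDerivWithinAt
  have hconst := (convex_ball s ε).is_const_of_fderivWithin_eq_zero (𝕜 := ℝ)
    (f := fun u => e (γ u) - (u - s) • e₀)
    (fun u hu => (hd u hu).differentiableWithinAt)
    (fun u hu => by
      have := (hd u hu).hasFDerivWithinAt.fderivWithin
        (Metric.isOpen_ball.uniqueDiffWithinAt hu)
      rw [this]; ext; simp)
    ht (Metric.mem_ball_self hε)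
  simp only [sub_self, zero_smul, sub_zero] at hconst
  rw [← hconst, sub_add_cancel]

variable [T2Space M]

/-- Uniqueness of integral curves. -/
theorem integralCurve_unique (hbox : ∀ p, ∃ e, p ∈ e.source ∧ Straightens (M := M) e ξ e₀)
    {γ δ : ℝ → M} (hγ : IsMIntegralCurve (I := 𝓘(ℝ, E)) γ ξ)
    (hδ : IsMIntegralCurve (I := 𝓘(ℝ, E)) δ ξ) {s : ℝ} (h : γ s = δ s) : γ = δ := by
  have hcl : IsClosed {t | γ t = δ t} := isClosed_eq hγ.continuous hδ.continuous
  have hop : IsOpen {t | γ t = δ t} := by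
    rw [isOpen_iff_mem_nhds]
    intro t ht
    obtain ⟨e, hp, he⟩ := hbox (γ t)
    have ht' : γ t = δ t := ht
    filter_upwards [he.eventually_eq hγ hp, he.eventually_eq hδ (ht' ▸ hp)] with u h1 h2
    apply e.injOn h1.1 h2.1
    rw [h1.2, h2.2, ht']
  have := IsClopen.eq_univ ⟨hcl, hop⟩ ⟨s, h⟩
  funext t
  exact eq_univ_iff_forall.1 this t

/-- Inside the image of a straightening chart the flow is a translation. -/
theorem Straightens.integralCurve_eq (he : Straightens e ξ e₀) {γ : ℝ → M}
    (hγ : IsMIntegralCurve (I := 𝓘(ℝ, E)) γ ξ) (hs : γ 0 ∈ e.source) {t : ℝ}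
    (ht : e (γ 0) + t • e₀ ∈ e.target) : γ t = e.symm (e (γ 0) + t • e₀) := by
  -- Convexity of the image of the chart makes `J` an interval. On it, agreement with the straight
  -- line is an open and closed condition, so the curve cannot leave the chart and return elsewhere.
  let J : Set ℝ := {u | e (γ 0) + u • e₀ ∈ e.target}
  have hJc : Convex ℝ J := by
    intro u hu v hv a b ha hb hab
    have := he.convex hu hv ha hb hab
    change e (γ 0) + (a • u + b • v) • e₀ ∈ e.target
    convert this using 1
    have : e (γ 0) = (a + b) • e (γ 0) := by rw [hab, one_smul]
    conv_lhs => rw [this]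
    simp only [smul_eq_mul]
    module
  have hJo : IsOpen J := e.open_target.preimage (by fun_prop)
  have h0 : (0 : ℝ) ∈ J := by
    change e (γ 0) + (0 : ℝ) • e₀ ∈ e.target
    rw [zero_smul, add_zero]
    exact e.map_source hs
  have hcont : ContinuousOn (fun u : ℝ => e.symm (e (γ 0) + u • e₀)) J :=
    e.continuousOn_symm.comp (by fun_prop) fun u hu => hu
  let U : Set ℝ := {u | u ∈ J ∧ γ u = e.symm (e (γ 0) + u • e₀)}
  have hUo : IsOpen U := by
    rw [isOpen_iff_mem_nhds]
    rintro u ⟨huJ, hu⟩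
    have hus : γ u ∈ e.source := hu ▸ e.map_target huJ
    have heu : e (γ u) = e (γ 0) + u • e₀ := by rw [hu, e.right_inv huJ]
    filter_upwards [he.eventually_eq hγ hus, hJo.mem_nhds huJ] with v h1 h2
    refine ⟨h2, ?_⟩
    rw [← e.left_inv h1.1, h1.2, heu]
    congr 1
    module
  have hsub : closure U ∩ J ⊆ U := by
    rintro u ⟨hu, huJ⟩
    refine ⟨huJ, ?_⟩
    have h1 : ContinuousAt (fun u : ℝ => e.symm (e (γ 0) + u • e₀)) u :=
      hcont.continuousAt (hJo.mem_nhds huJ)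
    have hne : (𝓝[U] u).NeBot := mem_closure_iff_nhdsWithin_neBot.1 hu
    refine tendsto_nhds_unique (l := 𝓝[U] u) hγ.continuous.continuousAt.continuousWithinAt
      (h1.continuousWithinAt.tendsto.congr' ?_)
    filter_upwards [self_mem_nhdsWithin] with v hv using hv.2.symm
  have := hJc.isPreconnected.subset_of_closure_inter_subset hUo
    ⟨0, h0, h0, by simp [e.left_inv hs]⟩ hsub
  exact (this ht).2

/-- For small times the flow is a translation in a straightening chart, hence smooth; the group law
carries this to all times. -/
theorem exists_smooth_flow_of_complete
    (hbox : ∀ p, ∃ e, p ∈ e.source ∧ Straightens (M := M) e ξ e₀)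
    (hcomp : ∀ x : M, ∃ γ : ℝ → M, γ 0 = x ∧ IsMIntegralCurve (I := 𝓘(ℝ, E)) γ ξ) :
    ∃ ψ : Flow ℝ M, (∀ x : M, IsMIntegralCurve (I := 𝓘(ℝ, E)) (fun t => ψ t x) ξ) ∧
      ContMDiff (𝓘(ℝ, ℝ).prod 𝓘(ℝ, E)) 𝓘(ℝ, E) ∞ (fun q : ℝ × M => ψ q.1 q.2) := by
  choose γ hγ0 hγ using hcomp
  have hadd : ∀ s t x, γ x (s + t) = γ (γ x t) s := by
    intro s t x
    have h1 : IsMIntegralCurve (I := 𝓘(ℝ, E)) (fun s => γ x (s + t)) ξ := (hγ x).comp_add t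
    exact congrFun (integralCurve_unique hbox h1 (hγ (γ x t)) (s := 0)
      (by rw [zero_add, hγ0])) s
  have hsm : ContMDiff (𝓘(ℝ, ℝ).prod 𝓘(ℝ, E)) 𝓘(ℝ, E) ∞
      (Function.uncurry fun t x => γ x t) := by
    refine contMDiff_of_oneParameterGroup _ hadd (fun x => (hγ x).continuous) fun p => ?_
    obtain ⟨e, hp, he⟩ := hbox p
    have hc : ContinuousAt (fun q : ℝ × M => e q.2 + q.1 • e₀) (0, p) :=
      ((e.continuousAt hp).comp continuousAt_snd).add (continuousAt_fst.smul continuousAt_const)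
    have h1 : ∀ᶠ q : ℝ × M in 𝓝 (0, p), q.2 ∈ e.source ∧ e q.2 + q.1 • e₀ ∈ e.target := by
      refine ((continuous_snd.tendsto _).eventually (e.open_source.mem_nhds hp)).and
        (hc.eventually (e.open_target.mem_nhds ?_))
      simpa using e.map_source hp
    filter_upwards [h1.eventually_nhds] with q hq
    obtain ⟨hq1, hq2⟩ := hq.self_of_nhds
    have h2 : ContMDiffAt (𝓘(ℝ, ℝ).prod 𝓘(ℝ, E)) 𝓘(ℝ, E) ∞
        (fun q : ℝ × M => e.symm (e q.2 + q.1 • e₀)) q := by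
      have h3 : ContMDiffAt (𝓘(ℝ, ℝ).prod 𝓘(ℝ, E)) 𝓘(ℝ, E) ∞
          (fun q : ℝ × M => e q.2 + q.1 • e₀) q := by
        refine ContMDiffAt.add ?_ (contMDiffAt_fst.smul contMDiffAt_const)
        exact ContMDiffAt.comp q ((contMDiffOn_of_mem_maximalAtlas he.mem_atlas).contMDiffAt
          (e.open_source.mem_nhds hq1)) contMDiffAt_snd
      exact ContMDiffAt.comp (f := fun q : ℝ × M => e q.2 + q.1 • e₀) (g := e.symm) q
        ((contMDiffOn_symm_of_mem_maximalAtlas he.mem_atlas).contMDiffAt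
        (e.open_target.mem_nhds hq2)) h3
    refine h2.congr_of_eventuallyEq ?_
    filter_upwards [hq] with r hr
    have := he.integralCurve_eq (hγ r.2) (by rw [hγ0]; exact hr.1) (t := r.1)
      (by rw [hγ0]; exact hr.2)
    rw [hγ0] at this
    exact this
  exact ⟨⟨fun t x => γ x t, hsm.continuous, hadd, hγ0⟩, hγ, hsm⟩

end Straightening

/-! ### Differential forms in charts -/

section FormsInCharts

variable {E : Type*} [NormedAddCommGroup E] [NormedSpace ℝ E]
  {M : Type*} [TopologicalSpace M] [ChartedSpace E M]
  {N : Type*} [TopologicalSpace N] [ChartedSpace E N]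
  {P : Type*} [TopologicalSpace P] [ChartedSpace E P]

/-- The derivative of a map between manifolds as an endomorphism of the model space. -/
def tderiv (f : M → N) (x : M) : E →L[ℝ] E := mfderiv 𝓘(ℝ, E) 𝓘(ℝ, E) f x

/-- The value of a form as an alternating map on the model space. -/
def formAt {k : ℕ} (Ω : DiffForm E M k) (x : M) : E [⋀^Fin k]→L[ℝ] ℝ := Ω x

theorem tderiv_comp {g : N → P} {f : M → N} {x : M}
    (hg : MDifferentiableAt 𝓘(ℝ, E) 𝓘(ℝ, E) g (f x))
    (hf : MDifferentiableAt 𝓘(ℝ, E) 𝓘(ℝ, E) f x) :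
    tderiv (E := E) (g ∘ f) x = (tderiv (E := E) g (f x)).comp (tderiv f x) :=
  mfderiv_comp x hg hf

theorem tderiv_congr {f g : M → N} {x : M} (h : f =ᶠ[𝓝 x] g) :
    tderiv (E := E) f x = tderiv g x := by
  rw [tderiv, h.mfderiv_eq]
  rfl

theorem tderiv_id (x : M) : tderiv (id : M → M) x = .id ℝ E := mfderiv_id

theorem tderiv_eq_fderiv (f : E → E) (x : E) : tderiv f x = fderiv ℝ f x := mfderiv_eq_fderiv

theorem formAt_pullback {k : ℕ} (φ : M → M) (Ω : DiffForm E M k) (x : M) :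
    formAt (pullback φ Ω) x = (formAt Ω (φ x)).compContinuousLinearMap (tderiv φ x) := rfl

theorem chartRep_eq {k : ℕ} (e : OpenPartialHomeomorph M E) (Ω : DiffForm E M k) (y : E) :
    chartRep e Ω y = (formAt Ω (e.symm y)).compContinuousLinearMap (tderiv e.symm y) := rfl

variable {e e' : OpenPartialHomeomorph M E}

theorem tderiv_symm_comp_tderiv (he : e ∈ IsManifold.maximalAtlas 𝓘(ℝ, E) ∞ M) {y : E}
    (hy : y ∈ e.target) : (tderiv e.symm y).comp (tderiv e (e.symm y)) = .id ℝ E := by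
  have h1 := tderiv_comp (g := e.symm) (f := e) (x := e.symm y)
    (mdifferentiableAt_symm_of_mem_maximalAtlas he (by rwa [e.right_inv hy]))
    (mdifferentiableAt_of_mem_maximalAtlas he (e.map_target hy))
  rw [e.right_inv hy] at h1
  rw [← h1, ← tderiv_id (e.symm y)]
  refine tderiv_congr ?_
  filter_upwards [e.open_source.mem_nhds (e.map_target hy)] with x hx using e.left_inv hx

theorem tderiv_comp_tderiv_symm (he : e ∈ IsManifold.maximalAtlas 𝓘(ℝ, E) ∞ M) {y : E}
    (hy : y ∈ e.target) : (tderiv e (e.symm y)).comp (tderiv e.symm y) = .id ℝ E := by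
  rw [← tderiv_comp (mdifferentiableAt_of_mem_maximalAtlas he (e.map_target hy))
    (mdifferentiableAt_symm_of_mem_maximalAtlas he hy), ← tderiv_id y]
  refine tderiv_congr ?_
  filter_upwards [e.open_target.mem_nhds hy] with x hx using e.right_inv hx

theorem formAt_eq_chartRep {k : ℕ} (Ω : DiffForm E M k)
    (he : e ∈ IsManifold.maximalAtlas 𝓘(ℝ, E) ∞ M) {y : E} (hy : y ∈ e.target) :
    formAt Ω (e.symm y) = (chartRep e Ω y).compContinuousLinearMap (tderiv e (e.symm y)) := by
  rw [chartRep_eq]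
  ext v
  have h := DFunLike.congr_fun (tderiv_symm_comp_tderiv he hy)
  simp only [ContinuousLinearMap.comp_apply, ContinuousLinearMap.id_apply] at h
  simp [Function.comp_def, h]

theorem formAt_eq_of_chartRep_eq {k : ℕ} {α β : DiffForm E M k}
    (he : e ∈ IsManifold.maximalAtlas 𝓘(ℝ, E) ∞ M) {y : E} (hy : y ∈ e.target)
    (h : chartRep e α y = chartRep e β y) : α (e.symm y) = β (e.symm y) := by
  have h1 := formAt_eq_chartRep α he hy
  rw [h, ← formAt_eq_chartRep β he hy] at h1
  exact h1

theorem chartRep_pullback {k : ℕ} (Ω : DiffForm E M k)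
    (he : e ∈ IsManifold.maximalAtlas 𝓘(ℝ, E) ∞ M)
    (he' : e' ∈ IsManifold.maximalAtlas 𝓘(ℝ, E) ∞ M) {φ : M → M} {y : E} (hy : y ∈ e.target)
    (hφ : MDifferentiableAt 𝓘(ℝ, E) 𝓘(ℝ, E) φ (e.symm y)) (hφy : φ (e.symm y) ∈ e'.source) :
    chartRep e (pullback φ Ω) y = (chartRep e' Ω (e' (φ (e.symm y)))).compContinuousLinearMap
      (fderiv ℝ (e' ∘ φ ∘ e.symm) y) := by
  have hs := mdifferentiableAt_symm_of_mem_maximalAtlas he hy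
  have hφs : MDifferentiableAt 𝓘(ℝ, E) 𝓘(ℝ, E) (φ ∘ e.symm) y := MDifferentiableAt.comp y hφ hs
  have hG : MDifferentiableAt 𝓘(ℝ, E) 𝓘(ℝ, E) (e' ∘ φ ∘ e.symm) y :=
    MDifferentiableAt.comp y (mdifferentiableAt_of_mem_maximalAtlas he' hφy) hφs
  have h1 : tderiv (E := E) (φ ∘ e.symm) y =
      (tderiv e'.symm (e' (φ (e.symm y)))).comp (tderiv (e' ∘ φ ∘ e.symm) y) := by
    have := tderiv_comp (g := e'.symm) (f := e' ∘ φ ∘ e.symm) (x := y)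
      (mdifferentiableAt_symm_of_mem_maximalAtlas he' (e'.map_source hφy)) hG
    rw [Function.comp_apply, Function.comp_apply] at this
    rw [← this]
    refine tderiv_congr ?_
    filter_upwards [hφs.continuousAt.eventually (e'.open_source.mem_nhds hφy)] with z hz
    exact (e'.left_inv hz).symm
  rw [chartRep_eq, chartRep_eq, formAt_pullback, e'.left_inv hφy, ← tderiv_eq_fderiv]
  have h2 := tderiv_comp (g := φ) (f := e.symm) (x := y) hφ hs
  rw [h1] at h2
  ext v
  have h3 := DFunLike.congr_fun h2
  simp only [ContinuousLinearMap.comp_apply] at h3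
  change formAt Ω _ (fun i => tderiv φ _ (tderiv e.symm y (v i))) = formAt Ω _
    (fun i => tderiv e'.symm _ (tderiv (e' ∘ φ ∘ e.symm) y (v i)))
  simp only [h3]

/-- Only the germ of the local expression matters, so an explicit model such as a translation may
replace it. -/
theorem chartRep_pullback_congr {k : ℕ} {Ω : DiffForm E M k} {φ : M → M}
    (he : e ∈ IsManifold.maximalAtlas 𝓘(ℝ, E) ∞ M)
    (he' : e' ∈ IsManifold.maximalAtlas 𝓘(ℝ, E) ∞ M) {y : E} (hy : y ∈ e.target)
    (hφ : MDifferentiableAt 𝓘(ℝ, E) 𝓘(ℝ, E) φ (e.symm y)) (hφy : φ (e.symm y) ∈ e'.source)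
    {G : E → E} (hG : e' ∘ φ ∘ e.symm =ᶠ[𝓝 y] G) :
    chartRep e (pullback φ Ω) y =
      (chartRep e' Ω (G y)).compContinuousLinearMap (fderiv ℝ G y) := by
  rw [chartRep_pullback Ω he he' hy hφ hφy, hG.fderiv_eq, ← hG.self_of_nhds]
  rfl

end FormsInCharts

/-! ### Invariance of closed forms under a field with constant contraction -/

section Invariance

variable {E : Type*} [NormedAddCommGroup E] [NormedSpace ℝ E]

/-- This is `L_{e₀} α = ι_{e₀} dα + d ι_{e₀} α = 0`. In the formula for `dα (e₀, v)` every term but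
the first differentiates a contraction of `α` with `e₀`, which is constant, so the derivative of `α`
along `e₀` vanishes. -/
theorem translation_invariant_of_closed {k : ℕ} {α : E → E [⋀^Fin (k + 1)]→L[ℝ] ℝ} {T : Set E}
    (hTo : IsOpen T) (hTc : Convex ℝ T) (hα : ContDiffOn ℝ ∞ α T)
    (hclosed : ∀ y ∈ T, extDeriv α y = 0) {e₀ : E}
    (hcontr : ∀ v : Fin k → E, ∃ c : ℝ, ∀ y ∈ T, α y (Fin.cons e₀ v) = c)
    {y : E} (hy : y ∈ T) {t : ℝ} (ht : y + t • e₀ ∈ T) : α (y + t • e₀) = α y := by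
  have hdα : ∀ z ∈ T, DifferentiableAt ℝ α z := fun z hz =>
    (hα.contDiffAt (hTo.mem_nhds hz)).differentiableAt (by simp)
  ext v
  have hd : ∀ z ∈ T, DifferentiableAt ℝ (fun z => α z v) z := by
    intro z hz
    exact (ContinuousAlternatingMap.apply ℝ E ℝ v).differentiableAt.comp z (hdα z hz)
  have hzero : ∀ z ∈ T, fderiv ℝ (fun z => α z v) z e₀ = 0 := by
    intro z hz
    have h1 := extDeriv_apply (hdα z hz) (Fin.cons e₀ v)
    rw [hclosed z hz, Fin.sum_univ_succ] at h1
    have h2 : ∀ j : Fin (k + 1), fderiv ℝ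
        (fun y => α y ((Fin.succ j).removeNth (Fin.cons e₀ v : Fin (k + 1 + 1) → E))) z = 0 := by
      intro j
      obtain ⟨c, hc⟩ := hcontr (j.removeNth v)
      have h3 : (fun y => α y ((Fin.succ j).removeNth (Fin.cons e₀ v : Fin (k + 1 + 1) → E)))
          =ᶠ[𝓝 z] fun _ => c := by
        filter_upwards [hTo.mem_nhds hz] with y hy
        rw [← hc y hy]
        congr 1
        funext i
        refine Fin.cases ?_ (fun i => ?_) i
        · simp [Fin.removeNth]
        · simp [Fin.removeNth, Fin.succ_succAbove_succ]
      rw [h3.fderiv_eq]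
      simp
    simp only [h2] at h1
    simpa using h1.symm
  have hline : ∀ u ∈ {u : ℝ | y + u • e₀ ∈ T},
      HasDerivAt (fun u : ℝ => α (y + u • e₀) v) 0 u := by
    intro u hu
    have h1 : HasDerivAt (fun u : ℝ => y + u • e₀) e₀ u := by
      simpa using ((hasDerivAt_id u).smul_const e₀).const_add y
    have h2 := (hd _ hu).hasFDerivAt.comp_hasDerivAt u h1
    rw [hzero _ hu] at h2
    exact h2
  have hconv : Convex ℝ {u : ℝ | y + u • e₀ ∈ T} := by
    intro u hu w hw a b ha hb hab
    have := hTc hu hw ha hb hab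
    change y + (a • u + b • w) • e₀ ∈ T
    convert this using 1
    have h1 : y = (a + b) • y := by rw [hab, one_smul]
    conv_lhs => rw [h1]
    simp only [smul_eq_mul]
    module
  have hopen : IsOpen {u : ℝ | y + u • e₀ ∈ T} := hTo.preimage (by fun_prop)
  have := hconv.is_const_of_fderivWithin_eq_zero (𝕜 := ℝ) (f := fun u : ℝ => α (y + u • e₀) v)
    (fun u hu => (hline u hu).hasDerivWithinAt.differentiableWithinAt)
    (fun u hu => by
      rw [(hline u hu).hasDerivWithinAt.hasFDerivWithinAt.fderivWithin
        (hopen.uniqueDiffWithinAt hu)]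
      ext; simp)
    (x := t) (y := 0) ht (by simpa using hy)
  simpa using this

end Invariance

/-! ### The Reeb flow preserves the cosymplectic structure -/

section ReebInvariance

variable {E : Type*} [NormedAddCommGroup E] [NormedSpace ℝ E]
  {M : Type*} [TopologicalSpace M] [ChartedSpace E M]
  {ξ : ∀ x : M, TangentSpace 𝓘(ℝ, E) x} {e₀ : E} {e : OpenPartialHomeomorph M E}
  {η : DiffForm E M 1} {Ω : DiffForm E M 2} {n : ℕ}

theorem Straightens.tderiv_symm (he : Straightens e ξ e₀) {y : E} (hy : y ∈ e.target) :
    tderiv e.symm y e₀ = ξ (e.symm y) := by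
  rw [← he.map_field _ (e.map_target hy)]
  exact DFunLike.congr_fun (tderiv_symm_comp_tderiv he.mem_atlas hy) (ξ (e.symm y))

theorem Straightens.chartRep_one (he : Straightens e ξ e₀) (hξ : IsReebField η Ω ξ) {y : E}
    (hy : y ∈ e.target) (v : Fin 0 → E) : chartRep e η y (Fin.cons e₀ v) = 1 := by
  rw [← (hξ (e.symm y)).1, chartRep_eq]
  change formAt η (e.symm y) _ = formAt η (e.symm y) _
  congr 1
  funext i
  rw [Subsingleton.elim i 0]
  exact he.tderiv_symm hy

theorem Straightens.chartRep_two (he : Straightens e ξ e₀) (hξ : IsReebField η Ω ξ) {y : E}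
    (hy : y ∈ e.target) (v : Fin 1 → E) : chartRep e Ω y (Fin.cons e₀ v) = 0 := by
  have h : formAt Ω (e.symm y) ![(ξ (e.symm y) : E), tderiv e.symm y (v 0)] = 0 :=
    (hξ (e.symm y)).2 _
  rw [← h, chartRep_eq]
  change formAt Ω (e.symm y) _ = formAt Ω (e.symm y) _
  congr 1
  funext i
  refine Fin.cases ?_ (fun i => ?_) i
  · exact he.tderiv_symm hy
  · rw [Subsingleton.elim i 0]
    rfl

theorem Straightens.chartRep_one_add (he : Straightens e ξ e₀) (hcos : IsCosymplectic n η Ω)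
    (hξ : IsReebField η Ω ξ) {y : E} (hy : y ∈ e.target) {t : ℝ} (ht : y + t • e₀ ∈ e.target) :
    chartRep e η (y + t • e₀) = chartRep e η y :=
  translation_invariant_of_closed e.open_target he.convex (hcos.smooth_one e he.mem_atlas)
    (hcos.closed_one e he.mem_atlas) (fun v => ⟨1, fun _ hz => he.chartRep_one hξ hz v⟩) hy ht

theorem Straightens.chartRep_two_add (he : Straightens e ξ e₀) (hcos : IsCosymplectic n η Ω)
    (hξ : IsReebField η Ω ξ) {y : E} (hy : y ∈ e.target) {t : ℝ} (ht : y + t • e₀ ∈ e.target) :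
    chartRep e Ω (y + t • e₀) = chartRep e Ω y :=
  translation_invariant_of_closed e.open_target he.convex (hcos.smooth_two e he.mem_atlas)
    (hcos.closed_two e he.mem_atlas) (fun v => ⟨0, fun _ hz => he.chartRep_two hξ hz v⟩) hy ht

/-- The maps of a smooth flow are diffeomorphisms. -/
def flowDiff (ψ : Flow ℝ M)
    (hψ : ContMDiff (𝓘(ℝ, ℝ).prod 𝓘(ℝ, E)) 𝓘(ℝ, E) ∞ (fun q : ℝ × M => ψ q.1 q.2)) (t : ℝ) :
    Diff E M where
  toFun := ψ t
  invFun := ψ (-t)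
  left_inv x := by rw [← ψ.map_add, neg_add_cancel, ψ.map_zero_apply]
  right_inv x := by rw [← ψ.map_add, add_neg_cancel, ψ.map_zero_apply]
  contMDiff_toFun := hψ.comp (contMDiff_const.prodMk contMDiff_id)
  contMDiff_invFun := hψ.comp (contMDiff_const.prodMk contMDiff_id)

/-- At a fixed point `x` the pullback is locally constant in `t`: near time `0` by the translation
formula in a chart, near time `s` by composing with `ψ_s`. A locally constant function on the line
is constant. -/
theorem pullback_flow_eq {k : ℕ} {α : DiffForm E M k} {ψ : Flow ℝ M}
    (hψ : ContMDiff (𝓘(ℝ, ℝ).prod 𝓘(ℝ, E)) 𝓘(ℝ, E) ∞ (fun q : ℝ × M => ψ q.1 q.2))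
    (hcurve : ∀ x : M, IsMIntegralCurve (I := 𝓘(ℝ, E)) (fun t => ψ t x) ξ)
    (hbox : ∀ p, ∃ e, p ∈ e.source ∧ Straightens (M := M) e ξ e₀) [T2Space M]
    (hα : ∀ e, Straightens (M := M) e ξ e₀ → ∀ y ∈ e.target, ∀ t : ℝ, y + t • e₀ ∈ e.target →
      chartRep e α (y + t • e₀) = chartRep e α y) (t : ℝ) :
    pullback (ψ t) α = α := by
  have hloc : ∀ x : M, ∀ᶠ t in 𝓝 (0 : ℝ), pullback (ψ t) α x = α x := by
    intro x
    obtain ⟨e, hx, he⟩ := hbox x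
    have hy : e x ∈ e.target := e.map_source hx
    have hc : ContinuousAt (fun t : ℝ => e x + t • e₀) 0 := by fun_prop
    filter_upwards [hc.eventually (e.open_target.mem_nhds (by simpa using hy))] with t ht
    have hψt : ∀ z ∈ e.target, z + t • e₀ ∈ e.target →
        ψ t (e.symm z) = e.symm (z + t • e₀) := by
      intro z hz hzt
      have := he.integralCurve_eq (hcurve (e.symm z)) (t := t)
        (by rw [ψ.map_zero_apply]; exact e.map_target hz)
        (by rw [ψ.map_zero_apply, e.right_inv hz]; exact hzt)
      rwa [ψ.map_zero_apply, e.right_inv hz] at this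
    have key : chartRep e (pullback (ψ t) α) (e x) = chartRep e α (e x) := by
      have hG : e ∘ ψ t ∘ e.symm =ᶠ[𝓝 (e x)] fun z => z + t • e₀ := by
        have hc' : ContinuousAt (fun z : E => z + t • e₀) (e x) := by fun_prop
        filter_upwards [e.open_target.mem_nhds hy,
          hc'.eventually (e.open_target.mem_nhds ht)] with z hz hzt
        rw [Function.comp_apply, Function.comp_apply, hψt z hz hzt, e.right_inv hzt]
      rw [chartRep_pullback_congr he.mem_atlas he.mem_atlas hy
        (φ := ψ t) ((flowDiff ψ hψ t).mdifferentiable (by simp) _)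
        (by rw [hψt _ hy ht]; exact e.map_target ht) hG, hα e he _ hy t ht]
      rw [fderiv_add_const, fderiv_fun_id]
      ext v
      simp
    have := formAt_eq_of_chartRep_eq he.mem_atlas hy key
    rwa [e.left_inv hx] at this
  funext x
  have hlc : IsLocallyConstant fun t => pullback (ψ t) α x := by
    rw [IsLocallyConstant.iff_eventually_eq]
    intro s
    have h1 : Filter.Tendsto (fun t => t - s) (𝓝 s) (𝓝 0) := by
      have : Continuous fun t : ℝ => t - s := by fun_prop
      simpa using this.tendsto s
    filter_upwards [h1.eventually (hloc (ψ s x))] with t ht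
    have h2 : (ψ t : M → M) = flowDiff ψ hψ (t - s) ∘ flowDiff ψ hψ s := by
      funext z
      change ψ t z = ψ (t - s) (ψ s z)
      rw [← ψ.map_add, sub_add_cancel]
    rw [h2, pullback_comp]
    change (formAt (pullback (ψ (t - s)) α) (ψ s x)).compContinuousLinearMap (tderiv (ψ s) x) =
      (formAt α (ψ s x)).compContinuousLinearMap (tderiv (ψ s) x)
    rw [show formAt (pullback (ψ (t - s)) α) (ψ s x) = formAt α (ψ s x) from ht]
  have := congrFun (hlc.eq_const 0) t
  rw [Function.const_apply] at this
  rw [this, ψ.map_zero, pullback_id]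

theorem flowDiff_mem_cosymp (hcos : IsCosymplectic n η Ω) (hξ : IsReebField η Ω ξ) {ψ : Flow ℝ M}
    (hψ : ContMDiff (𝓘(ℝ, ℝ).prod 𝓘(ℝ, E)) 𝓘(ℝ, E) ∞ (fun q : ℝ × M => ψ q.1 q.2))
    (hcurve : ∀ x : M, IsMIntegralCurve (I := 𝓘(ℝ, E)) (fun t => ψ t x) ξ)
    (hbox : ∀ p, ∃ e, p ∈ e.source ∧ Straightens (M := M) e ξ e₀) [T2Space M] (t : ℝ) :
    flowDiff ψ hψ t ∈ Cosymp η Ω :=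
  ⟨pullback_flow_eq hψ hcurve hbox (fun _ he _ hy _ ht => he.chartRep_one_add hcos hξ hy ht) t,
    pullback_flow_eq hψ hcurve hbox (fun _ he _ hy _ ht => he.chartRep_two_add hcos hξ hy ht) t⟩

end ReebInvariance

/-! ### Linear algebra of cosymplectic forms -/

section LinearAlgebra

variable {E : Type*} [NormedAddCommGroup E] [NormedSpace ℝ E]

theorem update_cons_zero {E : Type*} (u v x : E) : Function.update ![u, v] 0 x = ![x, v] := by
  funext i; fin_cases i <;> rfl

theorem update_cons_one {E : Type*} (u v x : E) : Function.update ![u, v] 1 x = ![u, x] := by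
  funext i; fin_cases i <;> rfl

/-- An alternating `1`-form as a linear form. -/
def oneForm (a : E [⋀^Fin 1]→L[ℝ] ℝ) : E →L[ℝ] ℝ :=
  (ContinuousAlternatingMap.ofSubsingleton ℝ E ℝ (0 : Fin 1)).symm a

theorem oneForm_apply (a : E [⋀^Fin 1]→L[ℝ] ℝ) (v : E) : oneForm a v = a ![v] := by
  change a _ = a _
  congr 1
  funext i
  rw [Subsingleton.elim i 0]
  rfl

/-- An alternating `2`-form as a bilinear form. -/
def twoForm (b : E [⋀^Fin 2]→L[ℝ] ℝ) : E →L[ℝ] E →L[ℝ] ℝ :=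
  LinearMap.mkContinuous₂ (LinearMap.mk₂ ℝ (fun u v => b ![u, v])
    (fun u u' v => by simpa only [update_cons_zero] using b.map_update_add ![0, v] 0 u u')
    (fun c u v => by simpa only [update_cons_zero] using b.map_update_smul ![0, v] 0 c u)
    (fun u v v' => by simpa only [update_cons_one] using b.map_update_add ![u, 0] 1 v v')
    (fun c u v => by simpa only [update_cons_one] using b.map_update_smul ![u, 0] 1 c v)) ‖b‖
    (fun u v => by
      have := b.le_opNorm ![u, v]
      rw [Fin.prod_univ_two, ← mul_assoc] at this
      exact this)

theorem twoForm_apply (b : E [⋀^Fin 2]→L[ℝ] ℝ) (u v : E) : twoForm b u v = b ![u, v] := rfl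

theorem twoForm_self (b : E [⋀^Fin 2]→L[ℝ] ℝ) (u : E) : twoForm b u u = 0 :=
  b.map_eq_zero_of_eq _ (i := 0) (j := 1) rfl (by simp)

theorem twoForm_swap (b : E [⋀^Fin 2]→L[ℝ] ℝ) (u v : E) : twoForm b u v = -twoForm b v u := by
  have h := twoForm_self b (u + v)
  simp only [map_add, add_apply, twoForm_self, zero_add, add_zero] at h
  linarith

/-- The unsymmetrized form of `a ∧ b ^ n`. -/
def wedgeTerm (n : ℕ) (a : E →L[ℝ] ℝ) (b : E →L[ℝ] E →L[ℝ] ℝ) (v : Fin (2 * n + 1) → E) : ℝ :=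
  a (v 0) * ∏ i : Fin n, b (v ⟨2 * i + 1, by omega⟩) (v ⟨2 * i + 2, by omega⟩)

/-- Each slot occurs in exactly one factor of the product: `l` is that factor and `c` is the product
of the others. This gives multilinearity and also the vanishing on vectors in both kernels. The
decidability instance is arbitrary because the fields of `MultilinearMap` require this. -/
theorem exists_wedgeTerm_update (n : ℕ) (a : E →L[ℝ] ℝ) (b : E →L[ℝ] E →L[ℝ] ℝ)
    [DecidableEq (Fin (2 * n + 1))] (v : Fin (2 * n + 1) → E) (j : Fin (2 * n + 1)) :
    ∃ (c : ℝ) (l : E →ₗ[ℝ] ℝ), (∀ x, wedgeTerm n a b (Function.update v j x) = l x * c) ∧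
      ∀ u, a u = 0 → (∀ w, b u w = 0) → (∀ w, b w u = 0) → l u = 0 := by
  obtain ⟨j, hj⟩ := j
  have hne : ∀ (k : ℕ) (hk : k < 2 * n + 1), k ≠ j → ∀ x : E,
      Function.update v ⟨j, hj⟩ x ⟨k, hk⟩ = v ⟨k, hk⟩ := fun k hk hkj x =>
    Function.update_of_ne (by simpa using hkj) _ _
  have hne0 : 0 ≠ j → ∀ x : E, Function.update v ⟨j, hj⟩ x 0 = v 0 := fun h x =>
    hne 0 (by omega) h x
  rcases Nat.eq_zero_or_pos j with rfl | hpos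
  · refine ⟨∏ i : Fin n, b (v ⟨2 * i + 1, by omega⟩) (v ⟨2 * i + 2, by omega⟩), a, fun x => ?_,
      fun u hu _ _ => hu⟩
    rw [wedgeTerm]
    congr 1
    · exact congrArg a (Function.update_self (⟨0, hj⟩ : Fin (2 * n + 1)) x v)
    · exact Finset.prod_congr rfl fun i _ => by
        rw [hne _ _ (by omega), hne _ _ (by omega)]
  -- A slot other than `0` is the first or second argument of the factor with index `k = (j - 1) /
  -- 2`.
  · obtain ⟨k, hk | hk⟩ : ∃ k, j = 2 * k + 1 ∨ j = 2 * k + 2 := ⟨(j - 1) / 2, by omega⟩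
    · have hkn : k < n := by omega
      subst hk
      refine ⟨a (v 0) * ∏ i ∈ Finset.univ.erase (⟨k, hkn⟩ : Fin n),
        b (v ⟨2 * i + 1, by omega⟩) (v ⟨2 * i + 2, by omega⟩),
        (b.flip (v ⟨2 * k + 2, by omega⟩) : E →ₗ[ℝ] ℝ), fun x => ?_, fun u _ h1 _ => h1 _⟩
      rw [wedgeTerm, hne0 (by omega), ← Finset.mul_prod_erase Finset.univ _
        (Finset.mem_univ (⟨k, hkn⟩ : Fin n)), Function.update_self, hne _ _ (by omega)]
      have : ∏ i ∈ Finset.univ.erase (⟨k, hkn⟩ : Fin n),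
          b (Function.update v ⟨2 * k + 1, hj⟩ x ⟨2 * i + 1, by omega⟩)
            (Function.update v ⟨2 * k + 1, hj⟩ x ⟨2 * i + 2, by omega⟩) =
          ∏ i ∈ Finset.univ.erase (⟨k, hkn⟩ : Fin n),
            b (v ⟨2 * i + 1, by omega⟩) (v ⟨2 * i + 2, by omega⟩) := by
        refine Finset.prod_congr rfl fun i hi => ?_
        have hik : (i : ℕ) ≠ k := fun h => (Finset.ne_of_mem_erase hi) (Fin.ext h)
        rw [hne _ _ (by omega), hne _ _ (by omega)]
      rw [this]
      simp only [ContinuousLinearMap.coe_coe, ContinuousLinearMap.flip_apply]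
      ring
    · have hkn : k < n := by omega
      subst hk
      refine ⟨a (v 0) * ∏ i ∈ Finset.univ.erase (⟨k, hkn⟩ : Fin n),
        b (v ⟨2 * i + 1, by omega⟩) (v ⟨2 * i + 2, by omega⟩),
        (b (v ⟨2 * k + 1, by omega⟩) : E →ₗ[ℝ] ℝ), fun x => ?_, fun u _ _ h2 => h2 _⟩
      rw [wedgeTerm, hne0 (by omega), ← Finset.mul_prod_erase Finset.univ _
        (Finset.mem_univ (⟨k, hkn⟩ : Fin n)), Function.update_self, hne _ _ (by omega)]
      have : ∏ i ∈ Finset.univ.erase (⟨k, hkn⟩ : Fin n),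
          b (Function.update v ⟨2 * k + 2, hj⟩ x ⟨2 * i + 1, by omega⟩)
            (Function.update v ⟨2 * k + 2, hj⟩ x ⟨2 * i + 2, by omega⟩) =
          ∏ i ∈ Finset.univ.erase (⟨k, hkn⟩ : Fin n),
            b (v ⟨2 * i + 1, by omega⟩) (v ⟨2 * i + 2, by omega⟩) := by
        refine Finset.prod_congr rfl fun i hi => ?_
        have hik : (i : ℕ) ≠ k := fun h => (Finset.ne_of_mem_erase hi) (Fin.ext h)
        rw [hne _ _ (by omega), hne _ _ (by omega)]
      rw [this]
      simp only [ContinuousLinearMap.coe_coe]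
      ring

/-- `wedgeTerm` as a multilinear map. -/
def wedgeMultilinear (n : ℕ) (a : E →L[ℝ] ℝ) (b : E →L[ℝ] E →L[ℝ] ℝ) :
    MultilinearMap ℝ (fun _ : Fin (2 * n + 1) => E) ℝ where
  toFun := wedgeTerm n a b
  map_update_add' v j x y := by
    obtain ⟨c, l, h, -⟩ := exists_wedgeTerm_update n a b v j
    rw [h, h, h, map_add, add_mul]
  map_update_smul' v j r x := by
    obtain ⟨c, l, h, -⟩ := exists_wedgeTerm_update n a b v j
    rw [h, h, map_smul, smul_mul_assoc]

/-- A top-degree alternating map that is nonzero on `v` makes `v` a basis. Replacing `v j` by `u`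
multiplies the value by the `j`-th coordinate of `u`, but it also kills every term of the wedge
product; so all coordinates of `u` vanish. -/
theorem eq_zero_of_wedge_ne_zero {n : ℕ} (hE : Module.finrank ℝ E = 2 * n + 1) {a : E →L[ℝ] ℝ}
    {b : E →L[ℝ] E →L[ℝ] ℝ} {v : Fin (2 * n + 1) → E}
    (hv : ∑ σ : Equiv.Perm (Fin (2 * n + 1)),
      ((Equiv.Perm.sign σ : ℤ) : ℝ) * wedgeTerm n a b (v ∘ σ) ≠ 0) {u : E} (ha : a u = 0)
    (hb : ∀ w, b u w = 0) (hb' : ∀ w, b w u = 0) : u = 0 := by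
  set A := MultilinearMap.alternatization (wedgeMultilinear n a b) with hA
  have hAapp : ∀ w, A w = ∑ σ : Equiv.Perm (Fin (2 * n + 1)),
      ((Equiv.Perm.sign σ : ℤ) : ℝ) * wedgeTerm n a b (w ∘ σ) := by
    intro w
    rw [hA, MultilinearMap.alternatization_apply]
    refine Finset.sum_congr rfl fun σ _ => ?_
    rw [Units.smul_def, zsmul_eq_mul]
    rfl
  have hAv : A v ≠ 0 := by rwa [hAapp]
  have hli : LinearIndependent ℝ v := by
    by_contra h
    exact hAv (A.map_linearDependent v h)
  let B := basisOfLinearIndependentOfCardEqFinrank hli (by simp [hE])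
  have hB : ∀ i, B i = v i := fun i => by simp [B]
  have hzero : ∀ j, A (Function.update v j u) = 0 := by
    intro j
    rw [hAapp]
    refine Finset.sum_eq_zero fun σ _ => ?_
    rw [Function.update_comp_equiv]
    obtain ⟨c, l, h, h'⟩ := exists_wedgeTerm_update n a b (v ∘ σ) (σ.symm j)
    rw [h, h' u ha hb hb', zero_mul, mul_zero]
  have hcoord : ∀ j, B.repr u j = 0 := by
    intro j
    have h1 : A (Function.update v j u) = B.repr u j * A v := by
      conv_lhs => rw [← B.sum_repr u]
      rw [A.map_update_sum, Finset.sum_eq_single j]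
      · rw [A.map_update_smul, hB, Function.update_eq_self, smul_eq_mul]
      · intro i _ hij
        rw [A.map_update_smul, hB, A.map_update_self v hij.symm, smul_zero]
      · simp
    rw [hzero j] at h1
    exact (mul_eq_zero.1 h1.symm).resolve_right hAv
  have : B.repr u = 0 := Finsupp.ext hcoord
  simpa using this

end LinearAlgebra

/-! ### Cosymplectomorphisms preserve the Reeb field and commute with its flow -/

section Nondegeneracy

variable {E : Type*} [NormedAddCommGroup E] [NormedSpace ℝ E]
  {M : Type*} [TopologicalSpace M] [ChartedSpace E M]
  {ξ : ∀ x : M, TangentSpace 𝓘(ℝ, E) x} {e₀ : E} {e : OpenPartialHomeomorph M E}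
  {η : DiffForm E M 1} {Ω : DiffForm E M 2} {n : ℕ}

theorem IsCosymplectic.eq_zero (hcos : IsCosymplectic n η Ω)
    (hE : Module.finrank ℝ E = 2 * n + 1) {x : M} {u : E}
    (h1 : oneForm (formAt η x) u = 0) (h2 : ∀ w, twoForm (formAt Ω x) u w = 0) : u = 0 := by
  obtain ⟨v, hv⟩ : ∃ v : Fin (2 * n + 1) → E, wedgeTop n η Ω x v ≠ 0 := hcos.volume x
  refine eq_zero_of_wedge_ne_zero (E := E) hE (a := oneForm (formAt η x)) (b := twoForm (formAt Ω x))
    (v := v) ?_ h1 h2 (fun w => by rw [twoForm_swap, h2, neg_zero])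
  intro h0
  refine hv (mul_eq_zero_of_right _ (Eq.trans ?_ h0))
  refine Finset.sum_congr rfl fun σ _ => ?_
  rw [wedgeTerm, oneForm_apply (E := E)]
  rfl

/-- The value of a vector field as a vector of the model space. -/
def fieldAt (ξ : ∀ x : M, TangentSpace 𝓘(ℝ, E) x) (x : M) : E := ξ x

theorem tderiv_comp_tderiv_diff_symm (φ : Diff E M) (x : M) :
    (tderiv φ (φ.symm x)).comp (tderiv φ.symm x) = .id ℝ E := by
  rw [← tderiv_comp (φ.mdifferentiable (by simp) _) (φ.symm.mdifferentiable (by simp) _),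
    ← tderiv_id x]
  congr 1
  funext y
  exact φ.apply_symm_apply y

/-- Cosymplectomorphisms preserve the Reeb field. -/
theorem tderiv_reeb (hcos : IsCosymplectic n η Ω) (hξ : IsReebField η Ω ξ)
    (hE : Module.finrank ℝ E = 2 * n + 1) {φ : Diff E M} (hφ : φ ∈ Cosymp η Ω) (x : M) :
    tderiv φ x (fieldAt ξ x) = fieldAt ξ (φ x) := by
  have hη : ∀ v : E, oneForm (formAt η (φ x)) (tderiv φ x v) = oneForm (formAt η x) v := by
    intro v
    rw [oneForm_apply, oneForm_apply]
    have h1 : formAt (pullback φ η) x = formAt η x := congrFun hφ.1 x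
    rw [← h1, formAt_pullback]
    change formAt η (φ x) _ = formAt η (φ x) _
    congr 1
    funext i
    rw [Subsingleton.elim i 0]
    rfl
  have hΩ : ∀ v w : E, twoForm (formAt Ω (φ x)) (tderiv φ x v) (tderiv φ x w) =
      twoForm (formAt Ω x) v w := by
    intro v w
    rw [twoForm_apply, twoForm_apply]
    have h1 : formAt (pullback φ Ω) x = formAt Ω x := congrFun hφ.2 x
    rw [← h1, formAt_pullback]
    change formAt Ω (φ x) _ = formAt Ω (φ x) _
    congr 1
    funext i
    fin_cases i <;> rfl
  have hη1 : ∀ y, oneForm (formAt η y) (fieldAt ξ y) = 1 := fun y =>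
    (oneForm_apply (formAt η y) (fieldAt ξ y)).trans (hξ y).1
  have hΩ1 : ∀ (y : M) (w : E), twoForm (formAt Ω y) (fieldAt ξ y) w = 0 := fun y w => (hξ y).2 w
  rw [← sub_eq_zero]
  refine hcos.eq_zero hE (x := φ x) ?_ fun w => ?_
  · rw [map_sub, hη]
    refine sub_eq_zero.2 ?_
    exact (hη1 x).trans (hη1 (φ x)).symm
  -- Invariance of `Ω` only controls pairs of vectors in the image of `dφ`; since `φ` is a
  -- diffeomorphism, every `w` is such a vector.
  · have hw : tderiv φ x (tderiv φ.symm (φ x) w) = w := by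
      have := DFunLike.congr_fun (tderiv_comp_tderiv_diff_symm φ (φ x)) w
      rwa [φ.symm_apply_apply] at this
    rw [map_sub, sub_apply]
    refine sub_eq_zero.2 (Eq.trans ?_ (hΩ1 (φ x) w).symm)
    rw [← hw]
    exact (hΩ _ _).trans (hΩ1 x _)

/-- Cosymplectomorphisms commute with the Reeb flow. -/
theorem apply_flow [T2Space M] (hcos : IsCosymplectic n η Ω) (hξ : IsReebField η Ω ξ)
    (hE : Module.finrank ℝ E = 2 * n + 1)
    (hbox : ∀ p, ∃ e, p ∈ e.source ∧ Straightens (M := M) e ξ e₀) {ψ : Flow ℝ M}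
    (hcurve : ∀ x : M, IsMIntegralCurve (I := 𝓘(ℝ, E)) (fun t => ψ t x) ξ)
    {φ : Diff E M} (hφ : φ ∈ Cosymp η Ω) (t : ℝ) (x : M) : φ (ψ t x) = ψ t (φ x) := by
  have h : IsMIntegralCurve (I := 𝓘(ℝ, E)) (fun t => φ (ψ t x)) ξ := by
    intro s
    have h1 := HasMFDerivAt.comp s (φ.mdifferentiable (by simp) (ψ s x)).hasMFDerivAt (hcurve x s)
    refine h1.congr_mfderiv ?_
    have h2 : ∀ r : ℝ, tderiv (E := E) φ (ψ s x) (r • fieldAt ξ (ψ s x)) =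
        r • fieldAt ξ (φ (ψ s x)) := fun r => by
      rw [map_smul, tderiv_reeb hcos hξ hE hφ (ψ s x)]
    exact ContinuousLinearMap.ext fun r => h2 r
  exact congrFun (integralCurve_unique hbox h (hcurve (φ x)) (s := 0)
    (by simp only [ψ.map_zero_apply])) t

end Nondegeneracy

/-! ### Rigidity of orbit-preserving cosymplectomorphisms -/

section Rigidity

variable {E : Type*} [NormedAddCommGroup E] [NormedSpace ℝ E]
  {M : Type*} [TopologicalSpace M] [ChartedSpace E M]
  {ξ : ∀ x : M, TangentSpace 𝓘(ℝ, E) x} {e₀ : E} {e : OpenPartialHomeomorph M E}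
  {η : DiffForm E M 1} {Ω : DiffForm E M 2} {n : ℕ}

/-- Every orbit of `ξ` meets the domain of `e` in at most one segment parallel to `e₀`. -/
def SeparatesOrbits (e : OpenPartialHomeomorph M E) (ξ : ∀ x : M, TangentSpace 𝓘(ℝ, E) x)
    (e₀ : E) : Prop :=
  ∀ x ∈ e.source, ∀ y ∈ e.source, SameOrbit ξ x y → ∃ d : ℝ, e y = e x + d • e₀

/-- A cosymplectomorphism that preserves the orbits is the identity near its fixed points. -/
theorem eventually_eq_of_preserves_orbits (hcos : IsCosymplectic n η Ω) (hξ : IsReebField η Ω ξ)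
    (he : Straightens e ξ e₀) (hsep : SeparatesOrbits e ξ e₀) {c : E →L[ℝ] ℝ} (hc : c e₀ = 1)
    {g : Diff E M} (hg : g ∈ Cosymp η Ω) (horb : ∀ x, SameOrbit ξ x (g x)) {x₀ : M}
    (hx₀ : x₀ ∈ e.source) (hfix : g x₀ = x₀) : ∀ᶠ x in 𝓝 x₀, g x = x := by
  have hy₀ : e x₀ ∈ e.target := e.map_source hx₀
  let U : Set E := {z | z ∈ e.target ∧ g (e.symm z) ∈ e.source}
  have hUo : IsOpen U :=
    (g.continuous.comp_continuousOn e.continuousOn_symm).isOpen_inter_preimage e.open_target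
      e.open_source
  have hyU : e x₀ ∈ U := ⟨hy₀, by rwa [e.left_inv hx₀, hfix]⟩
  let G : E → E := e ∘ g ∘ e.symm
  -- The displacement is parallel to `e₀`, and `c` reads off its length `τ(z) = c (G z - z)`.
  have hline : ∀ z ∈ U, G z = z + c (G z - z) • e₀ := by
    rintro z ⟨hz, hgz⟩
    obtain ⟨d, hd⟩ := hsep _ (e.map_target hz) _ hgz (horb _)
    rw [e.right_inv hz] at hd
    change e (g (e.symm z)) = _
    have : c (e (g (e.symm z)) - z) = d := by rw [hd]; simp [hc]
    change _ = z + c (e (g (e.symm z)) - z) • e₀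
    rw [this, hd]
  have hGd : ∀ z ∈ U, DifferentiableAt ℝ G z := by
    rintro z ⟨hz, hgz⟩
    have h1 : MDifferentiableAt 𝓘(ℝ, E) 𝓘(ℝ, E) (g ∘ e.symm) z :=
      MDifferentiableAt.comp z (g.mdifferentiable (by simp) _)
        (mdifferentiableAt_symm_of_mem_maximalAtlas he.mem_atlas hz)
    have h2 : MDifferentiableAt 𝓘(ℝ, E) 𝓘(ℝ, E) G z :=
      MDifferentiableAt.comp z (mdifferentiableAt_of_mem_maximalAtlas he.mem_atlas hgz) h1
    exact h2.differentiableAt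
  have hdz : ∀ z ∈ U, ∀ v, c (fderiv ℝ G z v - v) = 0 := by
    intro z hz v
    obtain ⟨hzt, hgz⟩ := id hz
    have hGt : G z ∈ e.target := e.map_source hgz
    have h1 : chartRep e (pullback g η) z = chartRep e η z := by rw [hg.1]
    rw [chartRep_pullback η he.mem_atlas he.mem_atlas hzt (g.mdifferentiable (by simp) _) hgz] at h1
    change (chartRep e η (G z)).compContinuousLinearMap (fderiv ℝ G z) = _ at h1
    -- Translation invariance of `η` moves its value at `G z` back to `z`, so that `g^* η = η`
    -- becomes an identity at one point.
    rw [hline z hz, he.chartRep_one_add hcos hξ hzt (by rw [← hline z hz]; exact hGt)] at h1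
    have h2 : oneForm (chartRep e η z) (fderiv ℝ G z v) = oneForm (chartRep e η z) v := by
      rw [oneForm_apply, oneForm_apply]
      conv_rhs => rw [← h1]
      change chartRep e η z _ = chartRep e η z _
      congr 1
      funext i
      rw [Subsingleton.elim i 0]
      rfl
    have h3 : fderiv ℝ G z = .id ℝ E +
        ((c.comp (fderiv ℝ G z - .id ℝ E)).smulRight e₀) := by
      have hd1 : HasFDerivAt (fun z => z + c (G z - z) • e₀)
          (.id ℝ E + ((c.comp (fderiv ℝ G z - .id ℝ E)).smulRight e₀)) z :=
        (hasFDerivAt_id z).add ((c.hasFDerivAt.comp z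
          ((hGd z hz).hasFDerivAt.sub (hasFDerivAt_id z))).smul_const e₀)
      have hd2 : HasFDerivAt G
          (.id ℝ E + ((c.comp (fderiv ℝ G z - .id ℝ E)).smulRight e₀)) z := by
        refine hd1.congr_of_eventuallyEq ?_
        filter_upwards [hUo.mem_nhds hz] with w hw using hline w hw
      exact hd2.fderiv
    have h4 : fderiv ℝ G z v = v + c (fderiv ℝ G z v - v) • e₀ := by
      conv_lhs => rw [h3]
      simp
    have h5 : oneForm (chartRep e η z) e₀ = 1 := by
      rw [oneForm_apply]
      exact he.chartRep_one hξ hzt _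
    -- Since `dG v = v + dτ(v) e₀` and `η(e₀) = 1`, the identity `η(dG v) = η(v)` says that `dτ(v) =
    -- 0`.
    rw [h4, map_add, map_smul, h5, smul_eq_mul, mul_one] at h2
    linarith
  obtain ⟨ε, hε, hball⟩ := Metric.isOpen_iff.1 hUo _ hyU
  have hconst : ∀ z ∈ Metric.ball (e x₀) ε, c (G z - z) = 0 := by
    intro z hz
    have hd : ∀ w ∈ Metric.ball (e x₀) ε,
        HasFDerivAt (fun w => c (G w - w)) (c.comp (fderiv ℝ G w - .id ℝ E)) w := fun w hw =>
      c.hasFDerivAt.comp w ((hGd w (hball hw)).hasFDerivAt.sub (hasFDerivAt_id w))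
    have h0 := (convex_ball (e x₀) ε).is_const_of_fderivWithin_eq_zero (𝕜 := ℝ)
      (f := fun w => c (G w - w))
      (fun w hw => (hd w hw).differentiableAt.differentiableWithinAt)
      (fun w hw => by
        rw [(hd w hw).hasFDerivWithinAt.fderivWithin (Metric.isOpen_ball.uniqueDiffWithinAt hw)]
        ext v
        exact hdz w (hball hw) v)
      hz (Metric.mem_ball_self hε)
    rw [h0]
    change c (e (g (e.symm (e x₀))) - e x₀) = 0
    rw [e.left_inv hx₀, hfix, sub_self, map_zero]
  filter_upwards [(e.continuousAt hx₀).eventually (Metric.ball_mem_nhds _ hε),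
    e.open_source.mem_nhds hx₀] with x hx hxs
  have h1 := hline (e x) (hball hx)
  rw [hconst _ hx, zero_smul, add_zero] at h1
  have h2 := (hball hx).2
  rw [e.left_inv hxs] at h2
  change e (g (e.symm (e x))) = e x at h1
  rw [e.left_inv hxs] at h1
  exact e.injOn h2 hxs h1

/-- The fixed point set is closed, and open by local rigidity. Besides its use for central elements,
it applies to the flow maps: a time that is a period of one orbit is a period of all. -/
theorem eq_id_of_preserves_orbits [T2Space M] [ConnectedSpace M] (hcos : IsCosymplectic n η Ω)
    (hξ : IsReebField η Ω ξ) (hbox : ∀ p, ∃ e, p ∈ e.source ∧ Straightens (M := M) e ξ e₀ ∧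
      SeparatesOrbits e ξ e₀) {c : E →L[ℝ] ℝ} (hc : c e₀ = 1)
    {g : Diff E M} (hg : g ∈ Cosymp η Ω) (horb : ∀ x, SameOrbit ξ x (g x)) {x₀ : M}
    (hfix : g x₀ = x₀) (x : M) : g x = x := by
  have hop : IsOpen {x | g x = x} := by
    rw [isOpen_iff_mem_nhds]
    intro y hy
    obtain ⟨e, hye, he, hsep⟩ := hbox y
    exact eventually_eq_of_preserves_orbits hcos hξ he hsep hc hg horb hye hy
  have := IsClopen.eq_univ ⟨isClosed_eq g.continuous continuous_id, hop⟩ ⟨x₀, hfix⟩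
  exact eq_univ_iff_forall.1 this x

end Rigidity

/-! ### Flows preserving forms on a normed space -/

section FlowInvariance

variable {E : Type*} [NormedAddCommGroup E] [NormedSpace ℝ E]

/-- The linearized flow equation. -/
theorem hasDerivAt_fderiv_flow {X : E → E} {Φ : ℝ → E → E} (hX : ContDiff ℝ ∞ X)
    (hΦ : ∀ x t, HasDerivAt (fun t => Φ t x) (X (Φ t x)) t)
    (hsm : ContDiff ℝ ∞ (Function.uncurry Φ)) (z v : E) (t : ℝ) :
    HasDerivAt (fun t => fderiv ℝ (Φ t) z v) (fderiv ℝ X (Φ t z) (fderiv ℝ (Φ t) z v)) t := by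
  set F := Function.uncurry Φ with hF
  have hd : Differentiable ℝ F := hsm.differentiable (by simp)
  have hd2 : Differentiable ℝ (fderiv ℝ F) :=
    (hsm.fderiv_right (m := ∞) (by simp)).differentiable (by simp)
  have h1 : ∀ s w u, fderiv ℝ (Φ s) w u = fderiv ℝ F (s, w) (0, u) := by
    intro s w u
    have : HasFDerivAt (Φ s) ((fderiv ℝ F (s, w)).comp (.inr ℝ ℝ E)) w :=
      (hd (s, w)).hasFDerivAt.comp w (hasFDerivAt_prodMk_right s w)
    rw [this.fderiv]
    rfl
  have h2 : ∀ s w, fderiv ℝ F (s, w) (1, 0) = X (Φ s w) := by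
    intro s w
    have hp : HasDerivAt (fun s : ℝ => (s, w)) ((1 : ℝ), (0 : E)) s :=
      (hasDerivAt_id s).prodMk (hasDerivAt_const s w)
    have : HasDerivAt (F ∘ fun s : ℝ => (s, w)) (fderiv ℝ F (s, w) (1, 0)) s :=
      (hd (s, w)).hasFDerivAt.comp_hasDerivAt s hp
    exact this.unique (hΦ w s)
  -- Symmetry of the second derivative of `F` exchanges differentiation in time with differentiation
  -- in the initial value.
  have hsymm : fderiv ℝ (fderiv ℝ F) (t, z) (1, 0) (0, v) =
      fderiv ℝ (fderiv ℝ F) (t, z) (0, v) (1, 0) :=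
    second_derivative_symmetric (f := F) (f' := fderiv ℝ F) (fun y => (hd y).hasFDerivAt)
      (hd2 (t, z)).hasFDerivAt _ _
  have h3 : HasDerivAt (fun s => fderiv ℝ F (s, z) (0, v))
      (fderiv ℝ (fderiv ℝ F) (t, z) (1, 0) (0, v)) t := by
    have := (hd2 (t, z)).hasFDerivAt.comp_hasDerivAt t
      ((hasDerivAt_id t).prodMk (hasDerivAt_const t z))
    have h := this.clm_apply (hasDerivAt_const t ((0 : ℝ), v))
    simpa using h
  have h4 : fderiv ℝ (fderiv ℝ F) (t, z) (0, v) (1, 0) =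
      fderiv ℝ X (Φ t z) (fderiv ℝ (Φ t) z v) := by
    have h5 : HasFDerivAt (fun w => fderiv ℝ F (t, w) (1, 0))
        (((fderiv ℝ (fderiv ℝ F) (t, z)).comp (.inr ℝ ℝ E)).flip (1, 0)) z := by
      have := (hd2 (t, z)).hasFDerivAt.comp z (hasFDerivAt_prodMk_right t z)
      have h := this.clm_apply (hasFDerivAt_const ((1 : ℝ), (0 : E)) z)
      simpa using h
    have h6 : HasFDerivAt (fun w => fderiv ℝ F (t, w) (1, 0))
        ((fderiv ℝ X (Φ t z)).comp (fderiv ℝ (Φ t) z)) z := by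
      have h7 : (fun w => fderiv ℝ F (t, w) (1, 0)) = X ∘ Φ t := funext fun w => h2 t w
      rw [h7]
      refine ((hX.differentiable (by simp)) _).hasFDerivAt.comp z ?_
      exact (hsm.comp (contDiff_prodMk_right t)).differentiable (by simp) z |>.hasFDerivAt
    have h8 := DFunLike.congr_fun (h5.unique h6) v
    simpa using h8
  rw [← h4, ← hsymm]
  simp only [h1]
  exact h3

/-- A closed `1`-form is preserved by the flow of a field on which it vanishes. -/
theorem flow_preserves_one {S : Set E} {A : E → E →L[ℝ] ℝ} {X : E → E}
    {Φ : ℝ → E → E} (hX : ContDiff ℝ ∞ X) (h0 : ∀ x, Φ 0 x = x)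
    (hΦ : ∀ x t, HasDerivAt (fun t => Φ t x) (X (Φ t x)) t)
    (hsm : ContDiff ℝ ∞ (Function.uncurry Φ)) (hSo : IsOpen S)
    (hA : ContDiffOn ℝ ∞ A S) (hcl : ∀ z ∈ S, ∀ u v, fderiv ℝ A z u v = fderiv ℝ A z v u)
    (hAX : ∀ z ∈ S, A z (X z) = 0) {z : E} (hz : ∀ t, Φ t z ∈ S) (t : ℝ) (v : E) :
    A (Φ t z) (fderiv ℝ (Φ t) z v) = A z v := by
  have hdA : ∀ w ∈ S, HasFDerivAt A (fderiv ℝ A w) w := fun w hw =>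
    ((hA.contDiffAt (hSo.mem_nhds hw)).differentiableAt (by simp)).hasFDerivAt
  have hdX : ∀ w, HasFDerivAt X (fderiv ℝ X w) w := fun w =>
    ((hX.differentiable (by simp)) w).hasFDerivAt
  -- This is the derivative of `A(X) = 0` in the direction `u`. With `dA = 0` it becomes the
  -- vanishing of the Lie derivative of `A` along `X`.
  have hid : ∀ w ∈ S, ∀ u, fderiv ℝ A w u (X w) + A w (fderiv ℝ X w u) = 0 := by
    intro w hw u
    have h1 := (hdA w hw).clm_apply (hdX w)
    have h2 : HasFDerivAt (fun y => A y (X y)) (0 : E →L[ℝ] ℝ) w := by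
      refine (hasFDerivAt_const (0 : ℝ) w).congr_of_eventuallyEq ?_
      filter_upwards [hSo.mem_nhds hw] with y hy using hAX y hy
    have := DFunLike.congr_fun (h1.unique h2) u
    simp only [add_apply, ContinuousLinearMap.comp_apply, ContinuousLinearMap.flip_apply,
      zero_apply] at this
    linarith
  have hder : ∀ s, HasDerivAt (fun s => A (Φ s z) (fderiv ℝ (Φ s) z v)) 0 s := by
    intro s
    have hA1 : HasDerivAt (fun s => A (Φ s z)) (fderiv ℝ A (Φ s z) (X (Φ s z))) s :=
      HasFDerivAt.comp_hasDerivAt (l := A) (f := fun s => Φ s z) s (hdA _ (hz s)) (hΦ z s)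
    have h1 := hA1.clm_apply (hasDerivAt_fderiv_flow hX hΦ hsm z v s)
    have h2 := hid _ (hz s) (fderiv ℝ (Φ s) z v)
    rw [← hcl _ (hz s)] at h2
    rw [h2] at h1
    exact h1
  have hconst := is_const_of_deriv_eq_zero (fun s => (hder s).differentiableAt)
    (fun s => (hder s).deriv) t 0
  have hΦ0 : Φ 0 = id := funext h0
  simpa [hΦ0] using hconst

/-- A closed `2`-form is preserved by the flow of a hamiltonian field. -/
theorem flow_preserves_two {S : Set E} {B : E → E →L[ℝ] E →L[ℝ] ℝ} {X : E → E} {h : E → ℝ}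
    {Φ : ℝ → E → E} (hX : ContDiff ℝ ∞ X) (h0 : ∀ x, Φ 0 x = x)
    (hΦ : ∀ x t, HasDerivAt (fun t => Φ t x) (X (Φ t x)) t)
    (hsm : ContDiff ℝ ∞ (Function.uncurry Φ)) (hSo : IsOpen S) (hh : ContDiff ℝ ∞ h)
    (hB : ContDiffOn ℝ ∞ B S)
    (hcl : ∀ z ∈ S, ∀ u v w,
      fderiv ℝ B z u v w - fderiv ℝ B z v u w + fderiv ℝ B z w u v = 0)
    (hskew : ∀ z ∈ S, ∀ u v, B z u v = -B z v u)
    (hBX : ∀ z ∈ S, ∀ w, B z (X z) w = fderiv ℝ h z w) {z : E} (hz : ∀ t, Φ t z ∈ S)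
    (t : ℝ) (u v : E) :
    B (Φ t z) (fderiv ℝ (Φ t) z u) (fderiv ℝ (Φ t) z v) = B z u v := by
  have hdB : ∀ w ∈ S, HasFDerivAt B (fderiv ℝ B w) w := fun w hw =>
    ((hB.contDiffAt (hSo.mem_nhds hw)).differentiableAt (by simp)).hasFDerivAt
  have hdX : ∀ w, HasFDerivAt X (fderiv ℝ X w) w := fun w =>
    ((hX.differentiable (by simp)) w).hasFDerivAt
  have hdh : ∀ w, HasFDerivAt (fderiv ℝ h) (fderiv ℝ (fderiv ℝ h) w) w := fun w =>
    ((hh.fderiv_right (m := ∞) (by simp)).differentiable (by simp) w).hasFDerivAt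
  -- The derivative of `B(X, v) = dh(v)` in the direction `u`. Subtracting the same identity with
  -- `u` and `v` exchanged cancels the Hessian of `h`; closedness of `B` then turns the difference
  -- into the Lie derivative along `X`.
  have hid : ∀ p ∈ S, ∀ u v, fderiv ℝ B p u (X p) v + B p (fderiv ℝ X p u) v =
      fderiv ℝ (fderiv ℝ h) p u v := by
    intro p hp u v
    have h1 := ((hdB p hp).clm_apply (hdX p)).clm_apply (hasFDerivAt_const v p)
    have h2 : HasFDerivAt (fun y => B y (X y) v) ((fderiv ℝ (fderiv ℝ h) p).flip v) p := by
      have h3 := (hdh p).clm_apply (hasFDerivAt_const v p)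
      simp only [ContinuousLinearMap.comp_zero, zero_add] at h3
      refine h3.congr_of_eventuallyEq ?_
      filter_upwards [hSo.mem_nhds hp] with y hy using hBX y hy v
    have := DFunLike.congr_fun (h1.unique h2) u
    simp only [add_apply, ContinuousLinearMap.comp_apply, ContinuousLinearMap.flip_apply,
      zero_apply, map_zero, zero_add] at this
    linarith
  have hsymm : ∀ p u v, fderiv ℝ (fderiv ℝ h) p u v = fderiv ℝ (fderiv ℝ h) p v u := fun p u v =>
    second_derivative_symmetric (fun y => ((hh.differentiable (by simp)) y).hasFDerivAt) (hdh p) u v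
  have hder : ∀ s, HasDerivAt (fun s => B (Φ s z) (fderiv ℝ (Φ s) z u) (fderiv ℝ (Φ s) z v)) 0 s := by
    intro s
    have hB1 : HasDerivAt (fun s => B (Φ s z)) (fderiv ℝ B (Φ s z) (X (Φ s z))) s :=
      HasFDerivAt.comp_hasDerivAt (l := B) (f := fun s => Φ s z) s (hdB _ (hz s)) (hΦ z s)
    have h1 := (hB1.clm_apply
      (hasDerivAt_fderiv_flow hX hΦ hsm z u s)).clm_apply (hasDerivAt_fderiv_flow hX hΦ hsm z v s)
    have hS := hz s
    set U := fderiv ℝ (Φ s) z u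
    set V := fderiv ℝ (Φ s) z v
    set p := Φ s z
    have h2 := hid p hS U V
    have h3 := hid p hS V U
    have h4 := hsymm p U V
    have h5 := hcl p hS (X p) U V
    have h6 := hskew p hS (fderiv ℝ X p V) U
    refine h1.congr_deriv ?_
    simp only [add_apply]
    change fderiv ℝ B p (X p) U V + B p (fderiv ℝ X p U) V + B p U (fderiv ℝ X p V) = 0
    linarith
  have hconst := is_const_of_deriv_eq_zero (fun s => (hder s).differentiableAt)
    (fun s => (hder s).deriv) t 0
  have hΦ0 : Φ 0 = id := funext h0
  simpa [hΦ0] using hconst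

end FlowInvariance

/-! ### Hamiltonian isotopies in a straightening chart -/

section LocalIsotopy

variable {E : Type*} [NormedAddCommGroup E] [NormedSpace ℝ E]

/-- `A` and `B` are a closed `1`-form and a closed `2`-form on the open set `T`, invariant under
the constant Reeb field `e₀`, and together nondegenerate. -/
structure IsReebInvariant (T : Set E) (e₀ : E) (A : E → E →L[ℝ] ℝ)
    (B : E → E →L[ℝ] E →L[ℝ] ℝ) : Prop where
  isOpen : IsOpen T
  smooth_one : ContDiffOn ℝ ∞ A T
  smooth_two : ContDiffOn ℝ ∞ B T
  closed_one : ∀ z ∈ T, ∀ u v, fderiv ℝ A z u v = fderiv ℝ A z v u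
  closed_two : ∀ z ∈ T, ∀ u v w,
    fderiv ℝ B z u v w - fderiv ℝ B z v u w + fderiv ℝ B z w u v = 0
  skew : ∀ z ∈ T, ∀ u v, B z u v = -B z v u
  reeb_one : ∀ z ∈ T, A z e₀ = 1
  reeb_two : ∀ z ∈ T, ∀ w, B z e₀ w = 0
  nondegenerate : ∀ z ∈ T, ∀ v, A z v = 0 → (∀ w, B z v w = 0) → v = 0
  invariant_one : ∀ z ∈ T, ∀ t : ℝ, z + t • e₀ ∈ T → A (z + t • e₀) = A z
  invariant_two : ∀ z ∈ T, ∀ t : ℝ, z + t • e₀ ∈ T → B (z + t • e₀) = B z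

/-- The projection onto the kernel of `c` along `e₀`. -/
def projKer (c : E →L[ℝ] ℝ) (e₀ : E) : E →L[ℝ] E := .id ℝ E - c.smulRight e₀

theorem projKer_apply (c : E →L[ℝ] ℝ) (e₀ z : E) : projKer c e₀ z = z - c z • e₀ := rfl

variable {T : Set E} {e₀ : E} {A : E → E →L[ℝ] ℝ} {B : E → E →L[ℝ] E →L[ℝ] ℝ} {c : E →L[ℝ] ℝ}

theorem projKer_self (hc : c e₀ = 1) : projKer c e₀ e₀ = 0 := by simp [projKer_apply, hc]

theorem projKer_add_smul (hc : c e₀ = 1) (z : E) (t : ℝ) :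
    projKer c e₀ (z + t • e₀) = projKer c e₀ z := by
  rw [map_add, map_smul, projKer_self hc, smul_zero, add_zero]

theorem projKer_add_self (c : E →L[ℝ] ℝ) (e₀ z : E) : projKer c e₀ z + c z • e₀ = z := by
  rw [projKer_apply, sub_add_cancel]

/-- The invariant extension to the preimage of `T` under the projection. -/
theorem IsReebInvariant.comp_projKer (h : IsReebInvariant T e₀ A B) (hc : c e₀ = 1) :
    IsReebInvariant (projKer c e₀ ⁻¹' T) e₀ (A ∘ projKer c e₀) (B ∘ projKer c e₀) := by
  -- Near `z`, invariance lets `f ∘ π` be replaced by `f` composed with the fixed translation by `-c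
  -- z • e₀`. So the two derivatives agree, although `π` itself has a kernel.
  have hloc : ∀ {F : Type _} [NormedAddCommGroup F] [NormedSpace ℝ F] (f : E → F),
      (∀ z ∈ T, ∀ t : ℝ, z + t • e₀ ∈ T → f (z + t • e₀) = f z) → ∀ z ∈ projKer c e₀ ⁻¹' T,
      fderiv ℝ (f ∘ projKer c e₀) z = fderiv ℝ f (projKer c e₀ z) := by
    intro F _ _ f hf z hz
    have h1 : f ∘ projKer c e₀ =ᶠ[𝓝 z] fun w => f (w - c z • e₀) := by
      have hcont : ContinuousAt (fun w : E => w - c z • e₀) z := by fun_prop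
      filter_upwards [hcont.eventually (h.isOpen.mem_nhds hz),
        (projKer c e₀).continuous.continuousAt.eventually (h.isOpen.mem_nhds hz)] with w hw hw'
      have h2 : (w - c z • e₀) = projKer c e₀ w + (c w - c z) • e₀ := by
        rw [projKer_apply]; module
      have hw2 : w - c z • e₀ ∈ T := hw
      rw [Function.comp_apply, h2]
      exact (hf _ hw' _ (h2 ▸ hw2)).symm
    rw [h1.fderiv_eq, fderiv_comp_sub]
    rfl
  exact
    { isOpen := h.isOpen.preimage (projKer c e₀).continuous
      smooth_one := h.smooth_one.comp (projKer c e₀).contDiff.contDiffOn fun _ hz => hz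
      smooth_two := h.smooth_two.comp (projKer c e₀).contDiff.contDiffOn fun _ hz => hz
      closed_one := fun z hz u v => by
        rw [hloc A h.invariant_one z hz]; exact h.closed_one _ hz u v
      closed_two := fun z hz u v w => by
        rw [hloc B h.invariant_two z hz]; exact h.closed_two _ hz u v w
      skew := fun z hz => h.skew _ hz
      reeb_one := fun z hz => h.reeb_one _ hz
      reeb_two := fun z hz => h.reeb_two _ hz
      nondegenerate := fun z hz => h.nondegenerate _ hz
      invariant_one := fun z _ t _ => by
        rw [Function.comp_apply, projKer_add_smul hc, Function.comp_apply]
      invariant_two := fun z _ t _ => by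
        rw [Function.comp_apply, projKer_add_smul hc, Function.comp_apply] }

/-- The isomorphism `v ↦ A v • A + B v` between the tangent and the cotangent space. -/
def musical (A : E → E →L[ℝ] ℝ) (B : E → E →L[ℝ] E →L[ℝ] ℝ) (z : E) : E →L[ℝ] E →L[ℝ] ℝ :=
  (A z).smulRight (A z) + B z

variable [FiniteDimensional ℝ E]

/-- If `A(v) A + B(v, ·) = 0`, evaluation at `e₀` gives `A(v) = 0`, then `B(v, ·) = 0`, and
nondegeneracy gives `v = 0`. Equality of dimensions does the rest. -/
theorem IsReebInvariant.exists_equiv (h : IsReebInvariant T e₀ A B) {z : E} (hz : z ∈ T) :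
    ∃ L : E ≃L[ℝ] (E →L[ℝ] ℝ), (L : E →L[ℝ] E →L[ℝ] ℝ) = musical A B z := by
  have hinj : Function.Injective (musical A B z : E →ₗ[ℝ] E →L[ℝ] ℝ) := by
    rw [← LinearMap.ker_eq_bot, LinearMap.ker_eq_bot']
    intro v hv
    have hv' : ∀ w, A z v * A z w + B z v w = 0 := fun w => DFunLike.congr_fun hv w
    have h1 : A z v = 0 := by
      have := hv' e₀
      rwa [h.reeb_one z hz, mul_one, h.skew z hz, h.reeb_two z hz, neg_zero, add_zero] at this
    refine h.nondegenerate z hz v h1 fun w => ?_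
    have := hv' w
    rwa [h1, zero_mul, zero_add] at this
  have hrank : Module.finrank ℝ E = Module.finrank ℝ (E →L[ℝ] ℝ) := by
    rw [← (LinearMap.toContinuousLinearMap : (E →ₗ[ℝ] ℝ) ≃ₗ[ℝ] E →L[ℝ] ℝ).finrank_eq]
    exact (Subspace.dual_finrank_eq (K := ℝ) (V := E)).symm
  let L := (LinearMap.linearEquivOfInjective _ hinj hrank).toContinuousLinearEquiv
  exact ⟨L, by ext v w; rfl⟩

theorem IsReebInvariant.contDiffAt_inverse (h : IsReebInvariant T e₀ A B) {z : E} (hz : z ∈ T) :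
    ContDiffAt ℝ ∞ (fun z => (musical A B z).inverse) z := by
  obtain ⟨L, hL⟩ := h.exists_equiv hz
  have h1 : ContDiffAt ℝ ∞ (musical A B) z := by
    have hA := h.smooth_one.contDiffAt (h.isOpen.mem_nhds hz)
    exact (hA.smulRight hA).add (h.smooth_two.contDiffAt (h.isOpen.mem_nhds hz))
  exact ContDiffAt.comp (g := ContinuousLinearMap.inverse) z
    (hL ▸ contDiffAt_map_inverse L) h1

/-- The isotopy is the flow of the field `X` with `A(X) = 0` and `ι_X B = d(H ∘ π)`, where `π =
projKer c e₀` and `H` is a bump function times the linear form `l`. Near `0` the differential of `H`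
is `l`, and `l (π v₀) ≠ 0` makes `X 0` nonzero. -/
theorem IsReebInvariant.exists_isotopy (h : IsReebInvariant T e₀ A B) (hc : c e₀ = 1)
    {r : ℝ} (hr : 0 < r) (hrT : Metric.closedBall 0 r ⊆ T) {l : E →L[ℝ] ℝ} {v₀ : E}
    (hl : l (projKer c e₀ v₀) ≠ 0) :
    ∃ (Φ : ℝ → E → E) (w : E), (∀ x, Φ 0 x = x) ∧ (∀ s t x, Φ (s + t) x = Φ s (Φ t x)) ∧
      ContDiff ℝ ∞ (Function.uncurry Φ) ∧
      (∀ t z (s : ℝ), Φ t (z + s • e₀) = Φ t z + s • e₀) ∧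
      (∀ t z, projKer c e₀ z ∉ Metric.closedBall 0 r → Φ t z = z) ∧
      (∀ t, ∀ z ∈ projKer c e₀ ⁻¹' T, Φ t z ∈ projKer c e₀ ⁻¹' T) ∧
      (∀ t, ∀ z ∈ projKer c e₀ ⁻¹' T, ∀ v,
        A (projKer c e₀ (Φ t z)) (fderiv ℝ (Φ t) z v) = A (projKer c e₀ z) v) ∧
      (∀ t, ∀ z ∈ projKer c e₀ ⁻¹' T, ∀ u v,
        B (projKer c e₀ (Φ t z)) (fderiv ℝ (Φ t) z u) (fderiv ℝ (Φ t) z v) =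
          B (projKer c e₀ z) u v) ∧
      HasDerivAt (fun t => Φ t 0) w 0 ∧ w ≠ 0 := by
  set π := projKer c e₀ with hπ
  let f : ContDiffBump (0 : E) := ⟨r / 2, r, by linarith, by linarith⟩
  let H : E → ℝ := fun z => f z * l z
  have hH : ContDiff ℝ ∞ H := f.contDiff.mul l.contDiff
  have hsupp : ∀ z ∉ Metric.closedBall (0 : E) r, H =ᶠ[𝓝 z] fun _ => 0 := by
    intro z hz
    filter_upwards [Metric.isClosed_closedBall.isOpen_compl.mem_nhds hz] with y hy
    have : f y = 0 := f.zero_of_le_dist (le_of_lt (by simpa using hy))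
    simp [H, this]
  -- Composition with `π` makes `θ` vanish on `e₀`. Evaluating `A(Y) A + B(Y, ·) = θ` at `e₀` then
  -- gives `A(Y) = 0` on the transversal.
  let θ : E → E →L[ℝ] ℝ := fun z => (fderiv ℝ H z).comp π
  have hθ : ContDiff ℝ ∞ θ := (hH.fderiv_right (m := ∞) (by simp)).clm_comp contDiff_const
  have hθ0 : ∀ z ∉ Metric.closedBall (0 : E) r, θ z = 0 := by
    intro z hz
    simp only [θ, (hsupp z hz).fderiv_eq]
    simp
  let Y : E → E := fun z => (musical A B z).inverse (θ z)
  have hY0 : ∀ z ∉ Metric.closedBall (0 : E) r, Y z = 0 := by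
    intro z hz
    simp only [Y, hθ0 z hz, map_zero]
  have hY : ContDiff ℝ ∞ Y := by
    rw [contDiff_iff_contDiffAt]
    intro z
    by_cases hz : z ∈ T
    · exact (h.contDiffAt_inverse hz).clm_apply hθ.contDiffAt
    · refine contDiffAt_const (c := (0 : E)) |>.congr_of_eventuallyEq ?_
      filter_upwards [Metric.isClosed_closedBall.isOpen_compl.mem_nhds
        (fun hz' => hz (hrT hz'))] with y hy using hY0 y hy
  have hYeq : ∀ z ∈ T, musical A B z (Y z) = θ z := by
    intro z hz
    obtain ⟨L, hL⟩ := h.exists_equiv hz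
    simp only [Y, ← hL, ContinuousLinearMap.inverse_equiv]
    exact L.apply_symm_apply _
  have hYc : HasCompactSupport Y :=
    HasCompactSupport.intro (isCompact_closedBall (0 : E) r) hY0
  obtain ⟨K, hK⟩ := ContDiff.lipschitzWith_of_hasCompactSupport hYc hY (by simp)
  obtain ⟨C, hC⟩ := hY.continuous.bounded_above_of_compact_support hYc
  -- Precomposition with `π` makes the field invariant along `e₀`; it loses compact support but
  -- stays bounded and Lipschitz.
  let X : E → E := Y ∘ π
  have hX : ContDiff ℝ ∞ X := hY.comp π.contDiff
  have hXL : LipschitzWith (K * ‖π‖₊) X := hK.comp π.lipschitz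
  obtain ⟨Φ, hΦ0, hΦadd, hΦd, hΦs⟩ := exists_smooth_flow (C := ⟨max C 0, le_max_right _ _⟩)
    hX hXL (fun x => (hC _).trans (le_max_left _ _))
  have huniq : ∀ (γ : ℝ → E) (x : E), γ 0 = x → (∀ t, HasDerivAt γ (X (γ t)) t) →
      ∀ t, Φ t x = γ t := by
    intro γ x hγ0 hγ t
    exact congrFun (ODE_solution_unique_univ (v := fun _ => X) (s := fun _ => univ)
      (f := fun t => Φ t x) (g := γ) (t₀ := 0) (fun _ => hXL.lipschitzOnWith)
      (fun s => ⟨hΦd x s, mem_univ _⟩) (fun s => ⟨hγ s, mem_univ _⟩)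
      (by simp only [hΦ0, hγ0])) t
  have htrans : ∀ t z (s : ℝ), Φ t (z + s • e₀) = Φ t z + s • e₀ := by
    intro t z s
    refine huniq (fun t => Φ t z + s • e₀) _ (by simp only [hΦ0]) (fun t => ?_) t
    have h1 : X (Φ t z + s • e₀) = X (Φ t z) := congrArg Y (projKer_add_smul hc _ _)
    rw [h1]
    exact (hΦd z t).add_const _
  have hfix : ∀ t z, π z ∉ Metric.closedBall 0 r → Φ t z = z := by
    intro t z hz
    refine huniq (fun _ => z) z rfl (fun t => ?_) t
    rw [show X z = 0 from hY0 _ hz]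
    exact hasDerivAt_const t z
  have hmaps : ∀ t, ∀ z ∈ π ⁻¹' T, Φ t z ∈ π ⁻¹' T := by
    intro t z hz
    -- If the image lies outside the support, it is fixed by `Φ (-t)`, so the point has not moved.
    by_cases h1 : π (Φ t z) ∈ Metric.closedBall 0 r
    · exact hrT h1
    · have h2 := hfix (-t) _ h1
      rw [← hΦadd, neg_add_cancel, hΦ0] at h2
      rwa [← h2]
  have hS := h.comp_projKer hc
  have hkey : ∀ z ∈ π ⁻¹' T, ∀ w, A (π z) (X z) * A (π z) w + B (π z) (X z) w =
      fderiv ℝ H (π z) (π w) := fun z hz w => DFunLike.congr_fun (hYeq (π z) hz) w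
  have hAX : ∀ z ∈ π ⁻¹' T, A (π z) (X z) = 0 := by
    intro z hz
    have := hkey z hz e₀
    rwa [hπ, projKer_self hc, map_zero, ← hπ, h.reeb_one _ hz, mul_one, h.skew _ hz,
      h.reeb_two _ hz, neg_zero, add_zero] at this
  have hBX : ∀ z ∈ π ⁻¹' T, ∀ w, B (π z) (X z) w = fderiv ℝ (H ∘ π) z w := by
    intro z hz w
    have h1 := hkey z hz w
    rw [hAX z hz, zero_mul, zero_add] at h1
    rw [h1, fderiv_comp _ ((hH.differentiable (by simp)) _) π.differentiableAt, π.fderiv]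
    rfl
  have h0T : (0 : E) ∈ T := hrT (Metric.mem_closedBall_self hr.le)
  refine ⟨Φ, X 0, hΦ0, hΦadd, hΦs, htrans, hfix, hmaps, ?_, ?_, ?_, ?_⟩
  · intro t z hz v
    exact flow_preserves_one hX hΦ0 hΦd hΦs hS.isOpen hS.smooth_one hS.closed_one hAX
      (fun s => hmaps s z hz) t v
  · intro t z hz u v
    exact flow_preserves_two hX hΦ0 hΦd hΦs hS.isOpen (hH.comp π.contDiff) hS.smooth_two
      hS.closed_two hS.skew hBX (fun s => hmaps s z hz) t u v
  · have := hΦd 0 0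
    rwa [hΦ0] at this
  · intro hX0
    have h1 := hYeq 0 h0T
    have hX0' : Y 0 = 0 := by
      have : X 0 = Y 0 := congrArg Y (map_zero π)
      rw [← this, hX0]
    rw [hX0', map_zero] at h1
    have h2 : fderiv ℝ H 0 = l := by
      have : H =ᶠ[𝓝 0] l := by
        filter_upwards [f.eventuallyEq_one] with y hy
        simp only [H, hy, Pi.one_apply, one_mul]
      rw [this.fderiv_eq, l.fderiv]
    have h3 := DFunLike.congr_fun h1 v₀
    simp only [θ, h2] at h3
    exact hl h3.symm

end LocalIsotopy

/-! ### From alternating maps in a chart to linear and bilinear forms -/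

section ChartForms

variable {E : Type*} [NormedAddCommGroup E] [NormedSpace ℝ E]

theorem fderiv_oneForm {α : E → E [⋀^Fin 1]→L[ℝ] ℝ} {z : E} (hα : DifferentiableAt ℝ α z)
    (hA : DifferentiableAt ℝ (fun z => oneForm (α z)) z) (u v : E) :
    fderiv ℝ (fun z => oneForm (α z)) z u v = fderiv ℝ α z u ![v] := by
  have h1 := hA.hasFDerivAt.clm_apply (hasFDerivAt_const v z)
  have h2 : HasFDerivAt (fun z => oneForm (α z) v)
      ((ContinuousAlternatingMap.apply ℝ E ℝ ![v]).comp (fderiv ℝ α z)) z := by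
    simp only [oneForm_apply]
    exact (ContinuousAlternatingMap.apply ℝ E ℝ ![v]).hasFDerivAt.comp z hα.hasFDerivAt
  simpa using DFunLike.congr_fun (h1.unique h2) u

theorem fderiv_twoForm {α : E → E [⋀^Fin 2]→L[ℝ] ℝ} {z : E} (hα : DifferentiableAt ℝ α z)
    (hB : DifferentiableAt ℝ (fun z => twoForm (α z)) z) (u v w : E) :
    fderiv ℝ (fun z => twoForm (α z)) z u v w = fderiv ℝ α z u ![v, w] := by
  have h1 := (hB.hasFDerivAt.clm_apply (hasFDerivAt_const v z)).clm_apply (hasFDerivAt_const w z)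
  have h2 : HasFDerivAt (fun z => twoForm (α z) v w)
      ((ContinuousAlternatingMap.apply ℝ E ℝ ![v, w]).comp (fderiv ℝ α z)) z :=
    (ContinuousAlternatingMap.apply ℝ E ℝ ![v, w]).hasFDerivAt.comp z hα.hasFDerivAt
  simpa using DFunLike.congr_fun (h1.unique h2) u

/-- In finite dimension smoothness of an operator-valued map can be tested on each vector. -/
theorem contDiffOn_oneForm [FiniteDimensional ℝ E] {α : E → E [⋀^Fin 1]→L[ℝ] ℝ} {T : Set E}
    (hα : ContDiffOn ℝ ∞ α T) : ContDiffOn ℝ ∞ (fun z => oneForm (α z)) T := by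
  rw [contDiffOn_clm_apply]
  intro v
  simp only [oneForm_apply]
  exact (ContinuousAlternatingMap.apply ℝ E ℝ ![v]).contDiff.comp_contDiffOn hα

theorem contDiffOn_twoForm [FiniteDimensional ℝ E] {α : E → E [⋀^Fin 2]→L[ℝ] ℝ} {T : Set E}
    (hα : ContDiffOn ℝ ∞ α T) : ContDiffOn ℝ ∞ (fun z => twoForm (α z)) T := by
  rw [contDiffOn_clm_apply]
  intro v
  rw [contDiffOn_clm_apply]
  intro w
  exact (ContinuousAlternatingMap.apply ℝ E ℝ ![v, w]).contDiff.comp_contDiffOn hα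

variable {M : Type*} [TopologicalSpace M] [ChartedSpace E M]
  {ξ : ∀ x : M, TangentSpace 𝓘(ℝ, E) x} {e₀ : E} {e : OpenPartialHomeomorph M E}
  {η : DiffForm E M 1} {Ω : DiffForm E M 2} {n : ℕ}

theorem oneForm_chartRep (e : OpenPartialHomeomorph M E) (η : DiffForm E M 1) (z v : E) :
    oneForm (chartRep e η z) v = oneForm (formAt η (e.symm z)) (tderiv e.symm z v) := by
  rw [oneForm_apply, oneForm_apply, chartRep_eq]
  change formAt η _ _ = formAt η _ _
  congr 1
  funext i
  rw [Subsingleton.elim i 0]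
  rfl

theorem twoForm_chartRep (e : OpenPartialHomeomorph M E) (Ω : DiffForm E M 2) (z u v : E) :
    twoForm (chartRep e Ω z) u v =
      twoForm (formAt Ω (e.symm z)) (tderiv e.symm z u) (tderiv e.symm z v) := by
  rw [twoForm_apply, twoForm_apply, chartRep_eq]
  change formAt Ω _ _ = formAt Ω _ _
  congr 1
  funext i
  fin_cases i <;> rfl

/-- The chart expressions of a cosymplectic structure in a chart straightening the Reeb field. -/
theorem Straightens.isReebInvariant [FiniteDimensional ℝ E] (he : Straightens e ξ e₀)
    (hcos : IsCosymplectic n η Ω) (hξ : IsReebField η Ω ξ)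
    (hE : Module.finrank ℝ E = 2 * n + 1) :
    IsReebInvariant e.target e₀ (fun z => oneForm (chartRep e η z))
      (fun z => twoForm (chartRep e Ω z)) := by
  have h1 := hcos.smooth_one e he.mem_atlas
  have h2 := hcos.smooth_two e he.mem_atlas
  have hd : ∀ {F : Type _} [NormedAddCommGroup F] [NormedSpace ℝ F] {f : E → F},
      ContDiffOn ℝ ∞ f e.target → ∀ z ∈ e.target, DifferentiableAt ℝ f z :=
    fun hf z hz => (hf.contDiffAt (e.open_target.mem_nhds hz)).differentiableAt (by simp)
  have h1' := contDiffOn_oneForm h1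
  have h2' := contDiffOn_twoForm h2
  refine ⟨e.open_target, h1', h2', ?_, ?_, fun z _ => twoForm_swap _, ?_, ?_, ?_, ?_, ?_⟩
  · intro z hz u v
    have h := DFunLike.congr_fun (hcos.closed_one e he.mem_atlas z hz) ![u, v]
    rw [extDeriv, ContinuousAlternatingMap.alternatizeUncurryFin_apply, Fin.sum_univ_two] at h
    rw [fderiv_oneForm (hd h1 z hz) (hd h1' z hz), fderiv_oneForm (hd h1 z hz) (hd h1' z hz)]
    have r0 : Fin.removeNth 0 ![u, v] = ![v] := by funext i; fin_cases i; rfl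
    have r1 : Fin.removeNth 1 ![u, v] = ![u] := by funext i; fin_cases i; rfl
    rw [r0, r1] at h
    simp at h
    linarith
  · intro z hz u v w
    have h := DFunLike.congr_fun (hcos.closed_two e he.mem_atlas z hz) ![u, v, w]
    rw [extDeriv, ContinuousAlternatingMap.alternatizeUncurryFin_apply, Fin.sum_univ_three] at h
    simp only [fderiv_twoForm (hd h2 z hz) (hd h2' z hz)]
    have r0 : Fin.removeNth 0 ![u, v, w] = ![v, w] := by funext i; fin_cases i <;> rfl
    have r1 : Fin.removeNth 1 ![u, v, w] = ![u, w] := by funext i; fin_cases i <;> rfl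
    have r2 : Fin.removeNth 2 ![u, v, w] = ![u, v] := by funext i; fin_cases i <;> rfl
    rw [r0, r1, r2] at h
    simp at h
    linarith
  · intro z hz
    rw [oneForm_apply]
    exact he.chartRep_one hξ hz _
  · intro z hz w
    rw [twoForm_apply]
    exact he.chartRep_two hξ hz _
  · intro z hz v hv hw
    have hD := tderiv_symm_comp_tderiv he.mem_atlas hz
    have hD' := tderiv_comp_tderiv_symm he.mem_atlas hz
    have hzero : tderiv e.symm z v = 0 := by
      refine hcos.eq_zero hE (x := e.symm z) ?_ fun w => ?_
      · rw [← oneForm_chartRep]; exact hv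
      · have h3 : tderiv e.symm z (tderiv e (e.symm z) w) = w := DFunLike.congr_fun hD w
        rw [← h3, ← twoForm_chartRep]
        exact hw _
    have h4 : tderiv e (e.symm z) (tderiv e.symm z v) = v := DFunLike.congr_fun hD' v
    rw [← h4, hzero, map_zero]
  · intro z hz t ht
    rw [he.chartRep_one_add hcos hξ hz ht]
  · intro z hz t ht
    rw [he.chartRep_two_add hcos hξ hz ht]

end ChartForms

/-! ### Extending invariant isotopies from a flow box -/

section Globalization

variable {E : Type*} [NormedAddCommGroup E] [NormedSpace ℝ E]
  {M : Type*} [TopologicalSpace M] [ChartedSpace E M]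
  {ξ : ∀ x : M, TangentSpace 𝓘(ℝ, E) x} {e₀ : E} {e : OpenPartialHomeomorph M E}
  {c : E →L[ℝ] ℝ} {ψ : Flow ℝ M} {Φ : ℝ → E → E} {r : ℝ}

theorem sameOrbit_iff [T2Space M] (hbox : ∀ p, ∃ e, p ∈ e.source ∧ Straightens (M := M) e ξ e₀)
    (hcurve : ∀ x : M, IsMIntegralCurve (I := 𝓘(ℝ, E)) (fun t => ψ t x) ξ) {x y : M} :
    SameOrbit ξ x y ↔ ∃ t, ψ t x = y := by
  constructor
  · rintro ⟨γ, hγ, s, t, rfl, rfl⟩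
    have := integralCurve_unique hbox hγ (hcurve (ψ (-s) (γ s))) (s := s)
      (by rw [← ψ.map_add, add_neg_cancel, ψ.map_zero_apply])
    refine ⟨t - s, ?_⟩
    rw [sub_eq_add_neg, ψ.map_add]
    exact (congrFun this t).symm
  · rintro ⟨t, rfl⟩
    exact ⟨fun t => ψ t x, hcurve x, 0, t, ψ.map_zero_apply x, rfl⟩

/-- A flow box of the complete field `ξ` with flow `ψ`, whose periodic orbits all have the same
periods. -/
structure IsFlowBox (e : OpenPartialHomeomorph M E) (ξ : ∀ x : M, TangentSpace 𝓘(ℝ, E) x)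
    (ψ : Flow ℝ M) (e₀ : E) (c : E →L[ℝ] ℝ) : Prop where
  straightens : Straightens e ξ e₀
  separates : ∀ x ∈ e.source, ∀ t, ψ t x ∈ e.source → ∃ d : ℝ, e (ψ t x) = e x + d • e₀
  normalized : c e₀ = 1
  projKer_mem : ∀ z ∈ e.target, projKer c e₀ z ∈ e.target
  curve : ∀ x : M, IsMIntegralCurve (I := 𝓘(ℝ, E)) (fun t => ψ t x) ξ
  smooth : ContMDiff (𝓘(ℝ, ℝ).prod 𝓘(ℝ, E)) 𝓘(ℝ, E) ∞ (fun q : ℝ × M => ψ q.1 q.2)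
  period : ∀ t x, ψ t x = x → ∀ y, ψ t y = y

/-- An isotopy of the cylinder over `projKer c e₀ ⁻¹' T` that commutes with the translations along
`e₀` and is supported over the closed ball of radius `r`. -/
structure IsCylinderIsotopy (Φ : ℝ → E → E) (T : Set E) (e₀ : E) (c : E →L[ℝ] ℝ) (r : ℝ) :
    Prop where
  zero : ∀ x, Φ 0 x = x
  add : ∀ s t x, Φ (s + t) x = Φ s (Φ t x)
  smooth : ContDiff ℝ ∞ (Function.uncurry Φ)
  translate : ∀ t z (s : ℝ), Φ t (z + s • e₀) = Φ t z + s • e₀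
  fixed : ∀ t z, projKer c e₀ z ∉ Metric.closedBall 0 r → Φ t z = z
  maps : ∀ t, ∀ z ∈ projKer c e₀ ⁻¹' T, Φ t z ∈ projKer c e₀ ⁻¹' T

/-- The extension of `e.symm` to the cylinder over `e.target`, equivariant under the flow. -/
def cylinderMap (ψ : Flow ℝ M) (e : OpenPartialHomeomorph M E) (e₀ : E) (c : E →L[ℝ] ℝ) (z : E) :
    M := ψ (c z) (e.symm (projKer c e₀ z))

open Classical in
/-- The map of `M` induced by a map `f` of the cylinder, extended by the identity. -/
def cylinderExtend (ψ : Flow ℝ M) (e : OpenPartialHomeomorph M E) (e₀ : E) (c : E →L[ℝ] ℝ)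
    (f : E → E) (x : M) : M :=
  if h : ∃ z ∈ projKer c e₀ ⁻¹' e.target, cylinderMap ψ e e₀ c z = x then
    cylinderMap ψ e e₀ c (f h.choose) else x

/-- The union of the orbits through the points of the transversal of `e` in the ball of
radius `r`. -/
def saturatedBall (ψ : Flow ℝ M) (e : OpenPartialHomeomorph M E) (e₀ : E) (c : E →L[ℝ] ℝ) (r : ℝ) :
    Set M :=
  {x | ∃ w ∈ Metric.closedBall (0 : E) r, projKer c e₀ w = w ∧ ∃ t, ψ t (e.symm w) = x}

theorem IsFlowBox.cylinderMap_add (h : IsFlowBox e ξ ψ e₀ c) (z : E) (s : ℝ) :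
    cylinderMap ψ e e₀ c (z + s • e₀) = ψ s (cylinderMap ψ e e₀ c z) := by
  rw [cylinderMap, cylinderMap, projKer_add_smul h.normalized, ← ψ.map_add, map_add, map_smul,
    h.normalized, smul_eq_mul, mul_one, add_comm]

theorem IsFlowBox.projKer_projKer (h : IsFlowBox e ξ ψ e₀ c) (z : E) :
    projKer c e₀ (projKer c e₀ z) = projKer c e₀ z := by
  conv_rhs => rw [← projKer_add_self c e₀ z, projKer_add_smul h.normalized]

theorem IsFlowBox.flow_symm [T2Space M] (h : IsFlowBox e ξ ψ e₀ c) {z : E} (hz : z ∈ e.target)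
    {t : ℝ} (ht : z + t • e₀ ∈ e.target) : ψ t (e.symm z) = e.symm (z + t • e₀) := by
  have := h.straightens.integralCurve_eq (h.curve (e.symm z)) (t := t)
    (by rw [ψ.map_zero_apply]; exact e.map_target hz)
    (by rw [ψ.map_zero_apply, e.right_inv hz]; exact ht)
  rwa [ψ.map_zero_apply, e.right_inv hz] at this

theorem IsFlowBox.cylinderMap_eq [T2Space M] (h : IsFlowBox e ξ ψ e₀ c) {z : E}
    (hz : z ∈ e.target) : cylinderMap ψ e e₀ c z = e.symm z := by
  rw [cylinderMap, h.flow_symm (h.projKer_mem z hz) (by rwa [projKer_add_self]), projKer_add_self]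

/-- Sliding both points along the flow to the transversal puts them in the chart on one orbit, which
meets the chart in a single line parallel to `e₀`. -/
theorem IsFlowBox.eq_add_of_cylinderMap_eq (h : IsFlowBox e ξ ψ e₀ c) {z w : E}
    (hz : z ∈ projKer c e₀ ⁻¹' e.target) (hw : w ∈ projKer c e₀ ⁻¹' e.target) {t : ℝ}
    (hzw : ψ t (cylinderMap ψ e e₀ c z) = cylinderMap ψ e e₀ c w) :
    projKer c e₀ w = projKer c e₀ z := by
  have h1 : ψ (-c w + (t + c z)) (e.symm (projKer c e₀ z)) = e.symm (projKer c e₀ w) := by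
    rw [ψ.map_add, ψ.map_add]
    change ψ (-c w) (ψ t (cylinderMap ψ e e₀ c z)) = _
    rw [hzw, cylinderMap, ← ψ.map_add, neg_add_cancel, ψ.map_zero_apply]
  obtain ⟨d, hd⟩ := h.separates _ (e.map_target hz) (-c w + (t + c z))
    (by rw [h1]; exact e.map_target hw)
  rw [h1, e.right_inv hw, e.right_inv hz] at hd
  have := congrArg (projKer c e₀) hd
  rwa [projKer_add_smul h.normalized, h.projKer_projKer, h.projKer_projKer] at this

/-- The value does not depend on the chosen preimage. Two preimages differ by `d • e₀` with `ψ_d`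
fixing a point; by the common period property `ψ_d` then fixes every point, in particular the image
under `Φ t`, which commutes with translations. -/
theorem cylinderExtend_cylinderMap (h : IsFlowBox e ξ ψ e₀ c)
    (hΦ : IsCylinderIsotopy Φ e.target e₀ c r) (t : ℝ) {z : E}
    (hz : z ∈ projKer c e₀ ⁻¹' e.target) :
    cylinderExtend ψ e e₀ c (Φ t) (cylinderMap ψ e e₀ c z) = cylinderMap ψ e e₀ c (Φ t z) := by
  have hex : ∃ w ∈ projKer c e₀ ⁻¹' e.target,
      cylinderMap ψ e e₀ c w = cylinderMap ψ e e₀ c z := ⟨z, hz, rfl⟩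
  rw [cylinderExtend, dif_pos hex]
  obtain ⟨hw, hwz⟩ := hex.choose_spec
  set w := hex.choose
  have h1 : projKer c e₀ w = projKer c e₀ z :=
    h.eq_add_of_cylinderMap_eq hz hw (t := 0) (by rw [ψ.map_zero_apply, hwz])
  have h2 : w = z + (c w - c z) • e₀ := calc
    w = projKer c e₀ w + c w • e₀ := (projKer_add_self c e₀ w).symm
    _ = projKer c e₀ z + c w • e₀ := by rw [h1]
    _ = z + (c w - c z) • e₀ := by rw [projKer_apply]; module
  set d := c w - c z
  have h3 := h.period d (cylinderMap ψ e e₀ c z) (by rw [← h.cylinderMap_add, ← h2, hwz])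
  rw [h2, hΦ.translate, h.cylinderMap_add, h3]

theorem cylinderExtend_of_notMem {M : Type*} [TopologicalSpace M] {ψ : Flow ℝ M}
    {e : OpenPartialHomeomorph M E} (f : E → E) {x : M}
    (hx : ¬∃ z ∈ projKer c e₀ ⁻¹' e.target, cylinderMap ψ e e₀ c z = x) :
    cylinderExtend ψ e e₀ c f x = x := dif_neg hx

theorem cylinderExtend_of_notMem_saturatedBall (h : IsFlowBox e ξ ψ e₀ c)
    (hΦ : IsCylinderIsotopy Φ e.target e₀ c r) (t : ℝ) {x : M}
    (hx : x ∉ saturatedBall ψ e e₀ c r) : cylinderExtend ψ e e₀ c (Φ t) x = x := by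
  by_cases hex : ∃ z ∈ projKer c e₀ ⁻¹' e.target, cylinderMap ψ e e₀ c z = x
  · obtain ⟨z, hz, rfl⟩ := hex
    rw [cylinderExtend_cylinderMap h hΦ t hz, hΦ.fixed]
    intro hball
    exact hx ⟨projKer c e₀ z, hball, h.projKer_projKer z, c z, rfl⟩
  · exact cylinderExtend_of_notMem _ hex

theorem cylinderExtend_zero (h : IsFlowBox e ξ ψ e₀ c)
    (hΦ : IsCylinderIsotopy Φ e.target e₀ c r) (x : M) :
    cylinderExtend ψ e e₀ c (Φ 0) x = x := by
  by_cases hex : ∃ z ∈ projKer c e₀ ⁻¹' e.target, cylinderMap ψ e e₀ c z = x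
  · obtain ⟨z, hz, rfl⟩ := hex
    rw [cylinderExtend_cylinderMap h hΦ 0 hz, hΦ.zero]
  · exact cylinderExtend_of_notMem _ hex

theorem cylinderExtend_add (h : IsFlowBox e ξ ψ e₀ c)
    (hΦ : IsCylinderIsotopy Φ e.target e₀ c r) (s t : ℝ) (x : M) :
    cylinderExtend ψ e e₀ c (Φ (s + t)) x =
      cylinderExtend ψ e e₀ c (Φ s) (cylinderExtend ψ e e₀ c (Φ t) x) := by
  by_cases hex : ∃ z ∈ projKer c e₀ ⁻¹' e.target, cylinderMap ψ e e₀ c z = x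
  · obtain ⟨z, hz, rfl⟩ := hex
    rw [cylinderExtend_cylinderMap h hΦ _ hz, cylinderExtend_cylinderMap h hΦ _ hz,
      cylinderExtend_cylinderMap h hΦ _ (hΦ.maps t z hz), hΦ.add]
  · rw [cylinderExtend_of_notMem _ hex, cylinderExtend_of_notMem _ hex,
      cylinderExtend_of_notMem _ hex]

theorem cylinderExtend_flow (h : IsFlowBox e ξ ψ e₀ c)
    (hΦ : IsCylinderIsotopy Φ e.target e₀ c r) (s t : ℝ) (x : M) :
    cylinderExtend ψ e e₀ c (Φ t) (ψ s x) = ψ s (cylinderExtend ψ e e₀ c (Φ t) x) := by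
  have hadd : ∀ (z : E) (s : ℝ), z ∈ projKer c e₀ ⁻¹' e.target →
      z + s • e₀ ∈ projKer c e₀ ⁻¹' e.target := fun z s hz => by
    rwa [mem_preimage, projKer_add_smul h.normalized]
  by_cases hex : ∃ z ∈ projKer c e₀ ⁻¹' e.target, cylinderMap ψ e e₀ c z = x
  · obtain ⟨z, hz, rfl⟩ := hex
    rw [← h.cylinderMap_add, cylinderExtend_cylinderMap h hΦ _ hz,
      cylinderExtend_cylinderMap h hΦ _ (hadd z s hz), hΦ.translate, h.cylinderMap_add]
  · rw [cylinderExtend_of_notMem _ hex, cylinderExtend_of_notMem]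
    rintro ⟨z, hz, hzx⟩
    refine hex ⟨z + (-s) • e₀, hadd z _ hz, ?_⟩
    rw [h.cylinderMap_add, hzx, ← ψ.map_add, neg_add_cancel, ψ.map_zero_apply]

/-- The set is the preimage of the image in the orbit space of a compact transversal ball, and
compact sets are closed in a Hausdorff space. -/
theorem isClosed_saturatedBall [T2Space M] [FiniteDimensional ℝ E] (h : IsFlowBox e ξ ψ e₀ c)
    (hbox : ∀ p, ∃ e, p ∈ e.source ∧ Straightens (M := M) e ξ e₀)
    (hT2 : T2Space (OrbitSpace ξ)) (hr : Metric.closedBall 0 r ⊆ e.target) :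
    IsClosed (saturatedBall ψ e e₀ c r) := by
  have hiff : ∀ x y : M, SameOrbit ξ x y ↔ ∃ t, ψ t x = y := fun x y =>
    sameOrbit_iff hbox h.curve
  have hequiv : Equivalence (SameOrbit ξ) := by
    refine ⟨fun x => (hiff _ _).2 ⟨0, ψ.map_zero_apply x⟩, fun {x y} hxy => ?_,
      fun {x y z} hxy hyz => ?_⟩
    · obtain ⟨t, rfl⟩ := (hiff _ _).1 hxy
      exact (hiff _ _).2 ⟨-t, by rw [← ψ.map_add, neg_add_cancel, ψ.map_zero_apply]⟩
    · obtain ⟨s, rfl⟩ := (hiff _ _).1 hxy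
      obtain ⟨t, rfl⟩ := (hiff _ _).1 hyz
      exact (hiff _ _).2 ⟨t + s, ψ.map_add t s x⟩
  let C : Set E := Metric.closedBall 0 r ∩ {w | projKer c e₀ w = w}
  have hC : IsCompact C := (isCompact_closedBall (0 : E) r).inter_right
    (isClosed_eq (projKer c e₀).continuous continuous_id)
  have hCM : IsCompact (e.symm '' C) :=
    hC.image_of_continuousOn (e.continuousOn_symm.mono (inter_subset_left.trans hr))
  have hq : Continuous (Quot.mk (SameOrbit ξ)) := continuous_quot_mk
  have heq : saturatedBall ψ e e₀ c r =
      Quot.mk (SameOrbit ξ) ⁻¹' (Quot.mk (SameOrbit ξ) '' (e.symm '' C)) := by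
    ext x
    constructor
    · rintro ⟨w, hw, hwp, t, rfl⟩
      exact ⟨e.symm w, ⟨w, ⟨hw, hwp⟩, rfl⟩, Quot.sound ((hiff _ _).2 ⟨t, rfl⟩)⟩
    · rintro ⟨_, ⟨w, ⟨hw, hwp⟩, rfl⟩, hx⟩
      have h1 : SameOrbit ξ (e.symm w) x :=
        hequiv.eqvGen_iff.1 (Quot.eqvGen_exact hx)
      exact ⟨w, hw, hwp, (hiff _ _).1 h1⟩
  rw [heq]
  exact (hCM.image hq).isClosed.preimage hq

theorem IsFlowBox.contMDiffOn_cylinderMap (h : IsFlowBox e ξ ψ e₀ c) :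
    ContMDiffOn 𝓘(ℝ, E) 𝓘(ℝ, E) ∞ (cylinderMap ψ e e₀ c) (projKer c e₀ ⁻¹' e.target) := by
  have h1 : ContMDiffOn 𝓘(ℝ, E) 𝓘(ℝ, E) ∞ (fun z => e.symm (projKer c e₀ z))
      (projKer c e₀ ⁻¹' e.target) :=
    (contMDiffOn_symm_of_mem_maximalAtlas h.straightens.mem_atlas).comp
      (projKer c e₀).contMDiff.contMDiffOn fun z hz => hz
  exact h.smooth.comp_contMDiffOn (c.contMDiff.contMDiffOn.prodMk h1)

/-- Two open sets cover `M`. On the saturation of the flow box, `cylinderMap` has smooth local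
sections and the map is expressed through `Φ`; on the complement of the closed saturated ball it is
the identity. -/
theorem contMDiff_cylinderExtend [T2Space M] [FiniteDimensional ℝ E] (h : IsFlowBox e ξ ψ e₀ c)
    (hbox : ∀ p, ∃ e, p ∈ e.source ∧ Straightens (M := M) e ξ e₀)
    (hT2 : T2Space (OrbitSpace ξ)) (hr : Metric.closedBall 0 r ⊆ e.target)
    (hΦ : IsCylinderIsotopy Φ e.target e₀ c r) :
    ContMDiff (𝓘(ℝ, ℝ).prod 𝓘(ℝ, E)) 𝓘(ℝ, E) ∞
      (fun q : ℝ × M => cylinderExtend ψ e e₀ c (Φ q.1) q.2) := by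
  rintro ⟨t, x⟩
  by_cases hex : ∃ z ∈ projKer c e₀ ⁻¹' e.target, cylinderMap ψ e e₀ c z = x
  · obtain ⟨z, hz, rfl⟩ := hex
    set s := c z
    set x := cylinderMap ψ e e₀ c z with hx
    have hback : ψ (-s) x = e.symm (projKer c e₀ z) := by
      rw [hx, cylinderMap, ← ψ.map_add, neg_add_cancel, ψ.map_zero_apply]
    have hsrc : ψ (-s) x ∈ e.source := hback ▸ e.map_target hz
    -- The second component is a local section of `cylinderMap`: flow back into the chart by time
    -- `-s`, then restore the time as a translation along `e₀`.
    let f : ℝ × M → ℝ × E := fun q => (q.1, e (ψ (-s) q.2) + s • e₀)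
    have hψs : ContMDiff (𝓘(ℝ, ℝ).prod 𝓘(ℝ, E)) 𝓘(ℝ, E) ∞ (fun q : ℝ × M => ψ (-s) q.2) :=
      h.smooth.comp (contMDiff_const.prodMk contMDiff_snd)
    have hf : ContMDiffAt (𝓘(ℝ, ℝ).prod 𝓘(ℝ, E)) (𝓘(ℝ, ℝ).prod 𝓘(ℝ, E)) ∞ f (t, x) := by
      refine contMDiffAt_fst.prodMk (ContMDiffAt.add ?_ contMDiffAt_const)
      exact ContMDiffAt.comp (t, x)
        ((contMDiffOn_of_mem_maximalAtlas h.straightens.mem_atlas).contMDiffAt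
          (e.open_source.mem_nhds hsrc)) hψs.contMDiffAt
    have hmem : ∀ y ∈ e.source, e y + s • e₀ ∈ projKer c e₀ ⁻¹' e.target := fun y hy => by
      rw [mem_preimage, projKer_add_smul h.normalized]
      exact h.projKer_mem _ (e.map_source hy)
    have hopen : IsOpen (projKer c e₀ ⁻¹' e.target) :=
      e.open_target.preimage (projKer c e₀).continuous
    have hΦs : ContMDiff (𝓘(ℝ, ℝ).prod 𝓘(ℝ, E)) 𝓘(ℝ, E) ∞ (Function.uncurry Φ) := by
      rw [← modelWithCornersSelf_prod, chartedSpaceSelf_prod]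
      exact hΦ.smooth.contMDiff
    have hΦf : ContMDiffAt (𝓘(ℝ, ℝ).prod 𝓘(ℝ, E)) 𝓘(ℝ, E) ∞
        (fun q => Function.uncurry Φ (f q)) (t, x) := hΦs.contMDiffAt.comp (t, x) hf
    have hP : ContMDiffAt (𝓘(ℝ, ℝ).prod 𝓘(ℝ, E)) 𝓘(ℝ, E) ∞
        (fun q => cylinderMap ψ e e₀ c (Function.uncurry Φ (f q))) (t, x) :=
      ContMDiffAt.comp (g := cylinderMap ψ e e₀ c) (f := fun q => Function.uncurry Φ (f q)) (t, x)
        (h.contMDiffOn_cylinderMap.contMDiffAt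
          (hopen.mem_nhds (hΦ.maps t _ (hmem _ hsrc)))) hΦf
    refine hP.congr_of_eventuallyEq ?_
    filter_upwards [hψs.continuous.continuousAt.eventually (e.open_source.mem_nhds hsrc)]
      with q hq
    have hq2 : q.2 = cylinderMap ψ e e₀ c (e (ψ (-s) q.2) + s • e₀) := by
      rw [h.cylinderMap_add, h.cylinderMap_eq (e.map_source hq), e.left_inv hq, ← ψ.map_add,
        add_neg_cancel, ψ.map_zero_apply]
    conv_lhs => rw [hq2]
    exact cylinderExtend_cylinderMap h hΦ q.1 (hmem _ hq)
  · have hx : x ∉ saturatedBall ψ e e₀ c r := by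
      rintro ⟨w, hw, hwp, s, rfl⟩
      have hwT := hr hw
      refine hex ⟨w + s • e₀, ?_, ?_⟩
      · rw [mem_preimage, projKer_add_smul h.normalized, hwp]
        exact hwT
      · rw [h.cylinderMap_add, h.cylinderMap_eq hwT]
    have hopen := (isClosed_saturatedBall h hbox hT2 hr).isOpen_compl
    refine contMDiffAt_snd.congr_of_eventuallyEq ?_
    filter_upwards [(continuous_snd.tendsto (t, x)).eventually (hopen.mem_nhds hx)] with q hq
    exact cylinderExtend_of_notMem_saturatedBall h hΦ q.1 hq

end Globalization

/-! ### Cosymplectic isotopies of the manifold and the action of central elements -/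

section CosymplecticIsotopy

variable {E : Type*} [NormedAddCommGroup E] [NormedSpace ℝ E]
  {M : Type*} [TopologicalSpace M] [ChartedSpace E M]
  {ξ : ∀ x : M, TangentSpace 𝓘(ℝ, E) x} {e₀ : E} {e : OpenPartialHomeomorph M E}
  {c : E →L[ℝ] ℝ} {ψ : Flow ℝ M} {Φ : ℝ → E → E} {r : ℝ}
  {η : DiffForm E M 1} {Ω : DiffForm E M 2} {n : ℕ}

/-- Invariant forms are determined along an orbit by their values at one point, so equalities need
checking only on the transversal. -/
theorem eq_of_pullback_flow_eq {k : ℕ} {α β : DiffForm E M k} {s : ℝ} {y : M}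
    (hα : pullback (ψ (-s)) α = α) (hβ : pullback (ψ (-s)) β = β) (h : α y = β y) :
    α (ψ s y) = β (ψ s y) := by
  have hy : ψ (-s) (ψ s y) = y := by rw [← ψ.map_add, neg_add_cancel, ψ.map_zero_apply]
  have h1 := formAt_pullback (ψ (-s)) α (ψ s y)
  have h2 := formAt_pullback (ψ (-s)) β (ψ s y)
  rw [hα, hy] at h1
  rw [hβ, hy, ← show formAt α y = formAt β y from h] at h2
  exact h1.trans h2.symm

/-- The field `ξ` is regular, in coordinate-free form. -/
structure HasFlowBoxes (ξ : ∀ x : M, TangentSpace 𝓘(ℝ, E) x) (e₀ : E) (c : E →L[ℝ] ℝ) : Prop where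
  normalized : c e₀ = 1
  exists_box : ∀ p, ∃ e, p ∈ e.source ∧ Straightens (M := M) e ξ e₀ ∧ SeparatesOrbits e ξ e₀ ∧
    e p = 0 ∧ ∀ z ∈ e.target, projKer c e₀ z ∈ e.target

theorem HasFlowBoxes.straightens (h : HasFlowBoxes (M := M) ξ e₀ c) (p : M) :
    ∃ e, p ∈ e.source ∧ Straightens (M := M) e ξ e₀ := by
  obtain ⟨e, hp, he, -⟩ := h.exists_box p
  exact ⟨e, hp, he⟩

variable [T2Space M]

theorem HasFlowBoxes.exists_isFlowBox [ConnectedSpace M] (h : HasFlowBoxes (M := M) ξ e₀ c)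
    (hcos : IsCosymplectic n η Ω) (hξ : IsReebField η Ω ξ)
    (hcurve : ∀ x : M, IsMIntegralCurve (I := 𝓘(ℝ, E)) (fun t => ψ t x) ξ)
    (hψ : ContMDiff (𝓘(ℝ, ℝ).prod 𝓘(ℝ, E)) 𝓘(ℝ, E) ∞ (fun q : ℝ × M => ψ q.1 q.2)) (p : M) :
    ∃ e, p ∈ e.source ∧ e p = 0 ∧ IsFlowBox e ξ ψ e₀ c := by
  obtain ⟨e, hp, he, hsep, hp0, hproj⟩ := h.exists_box p
  have hiff := fun x y => sameOrbit_iff h.straightens hcurve (x := x) (y := y)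
  refine ⟨e, hp, hp0, he, fun x hx t ht => hsep x hx _ ht ((hiff _ _).2 ⟨t, rfl⟩), h.normalized,
    hproj, hcurve, hψ, fun t x htx => ?_⟩
  refine eq_id_of_preserves_orbits hcos hξ (e₀ := e₀) (c := c) (fun q => ?_) h.normalized
    (flowDiff_mem_cosymp hcos hξ hψ hcurve h.straightens t)
    (fun y => (hiff _ _).2 ⟨t, rfl⟩) (x₀ := x) htx
  obtain ⟨e, hq, he, hsep, -⟩ := h.exists_box q
  exact ⟨e, hq, he, hsep⟩

/-- In dimension one there is only one orbit. -/
theorem exists_flow_eq_of_projKer_eq_zero [ConnectedSpace M] (h : HasFlowBoxes (M := M) ξ e₀ c)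
    (hcurve : ∀ x : M, IsMIntegralCurve (I := 𝓘(ℝ, E)) (fun t => ψ t x) ξ)
    (hE : ∀ v, projKer c e₀ v = 0) (x y : M) : ∃ t, ψ t x = y := by
  have hop : ∀ x, IsOpen {y | ∃ t, ψ t x = y} := by
    intro x
    rw [isOpen_iff_mem_nhds]
    rintro _ ⟨s, rfl⟩
    obtain ⟨e, hp, he⟩ := h.straightens (ψ s x)
    filter_upwards [e.open_source.mem_nhds hp] with y hy
    refine ⟨(c (e y) - c (e (ψ s x))) + s, ?_⟩
    have h1 : e y = e (ψ s x) + (c (e y) - c (e (ψ s x))) • e₀ := by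
      have h2 := projKer_add_self c e₀ (e y)
      have h3 := projKer_add_self c e₀ (e (ψ s x))
      rw [hE, zero_add] at h2 h3
      rw [sub_smul, h2, h3, add_sub_cancel]
    have h4 := he.integralCurve_eq (hcurve (ψ s x)) (t := c (e y) - c (e (ψ s x)))
      (by rw [ψ.map_zero_apply]; exact hp)
      (by rw [ψ.map_zero_apply, ← h1]; exact e.map_source hy)
    rw [ψ.map_zero_apply, ← h1, e.left_inv hy] at h4
    rw [ψ.map_add]
    exact h4
  have hcl : IsClosed {y | ∃ t, ψ t x = y} := by
    rw [← isOpen_compl_iff, isOpen_iff_mem_nhds]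
    intro z hz
    filter_upwards [(hop z).mem_nhds ⟨0, ψ.map_zero_apply z⟩] with w hw hxw
    obtain ⟨t, rfl⟩ := hw
    obtain ⟨s, hs⟩ := hxw
    refine hz ⟨-t + s, ?_⟩
    rw [ψ.map_add, hs, ← ψ.map_add, neg_add_cancel, ψ.map_zero_apply]
  have := IsClopen.eq_univ ⟨hcl, hop x⟩ ⟨x, 0, ψ.map_zero_apply x⟩
  exact eq_univ_iff_forall.1 this y

variable [FiniteDimensional ℝ E]

/-- The diffeomorphisms of `M` induced by an isotopy of the cylinder. -/
def isotopyDiff (h : IsFlowBox e ξ ψ e₀ c) (hΦ : IsCylinderIsotopy Φ e.target e₀ c r)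
    (hsm : ContMDiff (𝓘(ℝ, ℝ).prod 𝓘(ℝ, E)) 𝓘(ℝ, E) ∞
      (fun q : ℝ × M => cylinderExtend ψ e e₀ c (Φ q.1) q.2)) (t : ℝ) : Diff E M where
  toFun := cylinderExtend ψ e e₀ c (Φ t)
  invFun := cylinderExtend ψ e e₀ c (Φ (-t))
  left_inv x := by rw [← cylinderExtend_add h hΦ, neg_add_cancel, cylinderExtend_zero h hΦ]
  right_inv x := by rw [← cylinderExtend_add h hΦ, add_neg_cancel, cylinderExtend_zero h hΦ]
  contMDiff_toFun := hsm.comp (contMDiff_const.prodMk contMDiff_id)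
  contMDiff_invFun := hsm.comp (contMDiff_const.prodMk contMDiff_id)

/-- The extended map commutes with the flow, so the pulled back form is again flow-invariant and may
be compared with `α` on the transversal, where the chart expression is available. Outside the closed
saturated ball the map is locally the identity. -/
theorem pullback_cylinderExtend {k : ℕ} {α : DiffForm E M k} (h : IsFlowBox e ξ ψ e₀ c)
    (hbox : ∀ p, ∃ e, p ∈ e.source ∧ Straightens (M := M) e ξ e₀)
    (hT2 : T2Space (OrbitSpace ξ)) (hr : Metric.closedBall 0 r ⊆ e.target)
    (hΦ : IsCylinderIsotopy Φ e.target e₀ c r) (hψα : ∀ s, pullback (ψ s) α = α)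
    (hΦα : ∀ t, ∀ z ∈ e.target, projKer c e₀ z = z →
      (chartRep e α (projKer c e₀ (Φ t z))).compContinuousLinearMap (fderiv ℝ (Φ t) z) =
        chartRep e α z) (t : ℝ) :
    pullback (cylinderExtend ψ e e₀ c (Φ t)) α = α := by
  have hsm := contMDiff_cylinderExtend h hbox hT2 hr hΦ
  set g := isotopyDiff h hΦ hsm t with hg
  have hgc : (g : M → M) = cylinderExtend ψ e e₀ c (Φ t) := rfl
  rw [← hgc]
  have hcomm : ∀ s, pullback (ψ s) (pullback g α) = pullback g α := by
    intro s
    have h1 := pullback_comp g (flowDiff ψ h.smooth s) α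
    have h2 := pullback_comp (flowDiff ψ h.smooth s) g α
    have h3 : (g : M → M) ∘ flowDiff ψ h.smooth s = flowDiff ψ h.smooth s ∘ g :=
      funext fun x => cylinderExtend_flow h hΦ s t x
    rw [h3, h2] at h1
    change pullback g (pullback (ψ s) α) = pullback (ψ s) (pullback g α) at h1
    rw [hψα] at h1
    exact h1.symm
  funext x
  by_cases hex : ∃ z ∈ projKer c e₀ ⁻¹' e.target, cylinderMap ψ e e₀ c z = x
  · obtain ⟨z, hz, rfl⟩ := hex
    refine eq_of_pullback_flow_eq (hcomm _) (hψα _) ?_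
    set z₀ := projKer c e₀ z with hz₀
    have hz₀T : z₀ ∈ e.target := hz
    have hz₀p : projKer c e₀ z₀ = z₀ := h.projKer_projKer z
    set s := c (Φ t z₀) with hs
    -- The image of the transversal point may have left the chart along its orbit. Flowing back by
    -- `s`, its first coordinate on the cylinder, returns it to the transversal without changing the
    -- pullback of the invariant form `α`.
    set φ : Diff E M := flowDiff ψ h.smooth (-s) * g with hφ
    have hφα : pullback φ α = pullback g α := by
      have h1 := pullback_comp (flowDiff ψ h.smooth (-s)) g α
      change pullback φ α = pullback g (pullback (ψ (-s)) α) at h1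
      rw [h1, hψα]
    let G : E → E := fun w => Φ t w + (-s) • e₀
    have hΦt : ContDiff ℝ ∞ (Φ t) := hΦ.smooth.comp (contDiff_prodMk_right t)
    have hG0 : G z₀ = projKer c e₀ (Φ t z₀) := by
      rw [projKer_apply]
      simp only [G, ← hs]
      module
    have hφw : ∀ w ∈ e.target, G w ∈ e.target → φ (e.symm w) = e.symm (G w) := by
      intro w hw hGw
      change ψ (-s) (cylinderExtend ψ e e₀ c (Φ t) (e.symm w)) = _
      rw [← h.cylinderMap_eq hw, cylinderExtend_cylinderMap h hΦ t (h.projKer_mem w hw),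
        ← h.cylinderMap_add, h.cylinderMap_eq hGw]
    have hG0T : G z₀ ∈ e.target := by
      rw [hG0]
      exact hΦ.maps t z₀ (by rw [mem_preimage, hz₀p]; exact hz₀T)
    have hGc : Continuous G := hΦt.continuous.add continuous_const
    have hGe : e ∘ φ ∘ e.symm =ᶠ[𝓝 z₀] G := by
      filter_upwards [e.open_target.mem_nhds hz₀T,
        hGc.continuousAt.eventually (e.open_target.mem_nhds hG0T)] with w hw hGw
      rw [Function.comp_apply, Function.comp_apply, hφw w hw hGw, e.right_inv hGw]
    have hmem := h.straightens.mem_atlas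
    have key := chartRep_pullback_congr (Ω := α) hmem hmem hz₀T (φ.mdifferentiable (by simp) _)
      (by rw [hφw _ hz₀T hG0T]; exact e.map_target hG0T) hGe
    rw [hG0, show fderiv ℝ G z₀ = fderiv ℝ (Φ t) z₀ from fderiv_add_const _,
      hΦα t z₀ hz₀T hz₀p, hφα] at key
    exact formAt_eq_of_chartRep_eq hmem hz₀T key
  · have hx : x ∉ saturatedBall ψ e e₀ c r := by
      rintro ⟨w, hw, hwp, s, rfl⟩
      refine hex ⟨w + s • e₀, ?_, ?_⟩
      · rw [mem_preimage, projKer_add_smul h.normalized, hwp]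
        exact hr hw
      · rw [h.cylinderMap_add, h.cylinderMap_eq (hr hw)]
    have hev : (g : M → M) =ᶠ[𝓝 x] id := by
      filter_upwards [(isClosed_saturatedBall h hbox hT2 hr).isOpen_compl.mem_nhds hx] with y hy
      exact cylinderExtend_of_notMem_saturatedBall h hΦ t hy
    change formAt (pullback g α) x = formAt α x
    rw [formAt_pullback, tderiv_congr hev, tderiv_id, hev.self_of_nhds]
    ext v
    simp

/-- A cosymplectic isotopy that moves a given point and is supported near its orbit. -/
theorem exists_cosymp_isotopy (hcos : IsCosymplectic n η Ω) (hξ : IsReebField η Ω ξ)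
    (hE : Module.finrank ℝ E = 2 * n + 1) (h : IsFlowBox e ξ ψ e₀ c)
    (hbox : ∀ p, ∃ e, p ∈ e.source ∧ Straightens (M := M) e ξ e₀)
    (hT2 : T2Space (OrbitSpace ξ)) (hr0 : 0 < r) (hr : Metric.closedBall 0 r ⊆ e.target)
    {v₀ : E} (hv₀ : projKer c e₀ v₀ ≠ 0) :
    ∃ f : ℝ → Cosymp η Ω, (∀ t, f t ∈ Cosymp₀ η Ω) ∧
      (∀ t, ∀ x ∉ saturatedBall ψ e e₀ c r, (f t).1 x = x) ∧
      ∃ t, (f t).1 (e.symm 0) ≠ e.symm 0 := by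
  obtain ⟨l, hl⟩ := SeparatingDual.exists_ne_zero (R := ℝ) hv₀
  obtain ⟨Φ, w, hΦ0, hΦadd, hΦs, htr, hfix, hmaps, hA, hB, hw, hw0⟩ :=
    (h.straightens.isReebInvariant hcos hξ hE).exists_isotopy h.normalized hr0 hr hl
  have hΦ : IsCylinderIsotopy Φ e.target e₀ c r := ⟨hΦ0, hΦadd, hΦs, htr, hfix, hmaps⟩
  have hsm := contMDiff_cylinderExtend h hbox hT2 hr hΦ
  have hmem : ∀ t, isotopyDiff h hΦ hsm t ∈ Cosymp η Ω := by
    intro t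
    refine ⟨pullback_cylinderExtend h hbox hT2 hr hΦ (fun s =>
        (flowDiff_mem_cosymp hcos hξ h.smooth h.curve hbox s).1) ?_ t,
      pullback_cylinderExtend h hbox hT2 hr hΦ (fun s =>
        (flowDiff_mem_cosymp hcos hξ h.smooth h.curve hbox s).2) ?_ t⟩
    · intro t z hz hzp
      ext v
      have h1 := hA t z (by rw [mem_preimage, hzp]; exact hz) (v 0)
      simp only [oneForm_apply, hzp] at h1
      have hv : v = ![v 0] := by funext i; rw [Subsingleton.elim i 0]; rfl
      conv_rhs => rw [hv, ← h1]
      change chartRep e η _ _ = chartRep e η _ _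
      congr 1
      funext i
      rw [Subsingleton.elim i 0]
      rfl
    · intro t z hz hzp
      ext v
      have h1 := hB t z (by rw [mem_preimage, hzp]; exact hz) (v 0) (v 1)
      simp only [twoForm_apply, hzp] at h1
      have hv : v = ![v 0, v 1] := by funext i; fin_cases i <;> rfl
      conv_rhs => rw [hv, ← h1]
      change chartRep e Ω _ _ = chartRep e Ω _ _
      congr 1
      funext i
      fin_cases i <;> rfl
  refine ⟨fun t => ⟨isotopyDiff h hΦ hsm t, hmem t⟩, fun t => ?_, fun t x hx => ?_, ?_⟩
  · refine mem_cosymp₀_of_smooth_family (fun t => ⟨isotopyDiff h hΦ hsm t, hmem t⟩) ?_ hsm t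
    refine Subtype.ext (Diffeomorph.ext fun x => ?_)
    exact cylinderExtend_zero h hΦ x
  · exact cylinderExtend_of_notMem_saturatedBall h hΦ t hx
  -- If the point never moved, `Φ t 0` would be constant near `t = 0`, against its nonzero initial
  -- velocity `w`.
  · by_contra! hcon
    have h0 : (0 : E) ∈ e.target := hr (Metric.mem_closedBall_self hr0.le)
    have hev : ∀ᶠ t in 𝓝 (0 : ℝ), Φ t 0 = 0 := by
      have h1 : ∀ᶠ t in 𝓝 (0 : ℝ), Φ t 0 ∈ e.target :=
        hw.continuousAt.eventually (e.open_target.mem_nhds (show Φ 0 0 ∈ e.target by rw [hΦ0]; exact h0))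
      filter_upwards [h1] with t ht
      have h2 : cylinderExtend ψ e e₀ c (Φ t) (e.symm 0) = e.symm 0 := hcon t
      rw [← h.cylinderMap_eq h0, cylinderExtend_cylinderMap h hΦ t (h.projKer_mem 0 h0),
        h.cylinderMap_eq h0, h.cylinderMap_eq ht] at h2
      exact e.symm.injOn ht h0 h2
    have h3 : HasDerivAt (fun t => Φ t 0) 0 0 :=
      (hasDerivAt_const (0 : ℝ) (0 : E)).congr_of_eventuallyEq hev
    exact hw0 (hw.unique h3)

/-- Central elements preserve the orbits of the Reeb field. -/
theorem exists_flow_eq_of_mem_center [ConnectedSpace M] (h : HasFlowBoxes (M := M) ξ e₀ c)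
    (hcos : IsCosymplectic n η Ω) (hξ : IsReebField η Ω ξ)
    (hE : Module.finrank ℝ E = 2 * n + 1) (hT2 : T2Space (OrbitSpace ξ))
    (hcurve : ∀ x : M, IsMIntegralCurve (I := 𝓘(ℝ, E)) (fun t => ψ t x) ξ)
    (hψ : ContMDiff (𝓘(ℝ, ℝ).prod 𝓘(ℝ, E)) 𝓘(ℝ, E) ∞ (fun q : ℝ × M => ψ q.1 q.2))
    {g : Cosymp η Ω} (hg : g ∈ centerCosymp₀ η Ω) (x : M) : ∃ t, ψ t x = g.1 x := by
  by_cases hdim : ∀ v, projKer c e₀ v = 0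
  · exact exists_flow_eq_of_projKer_eq_zero h hcurve hdim _ _
  push Not at hdim
  obtain ⟨v₀, hv₀⟩ := hdim
  by_contra hcon
  obtain ⟨e, hx, hx0, hbox⟩ := h.exists_isFlowBox hcos hξ hcurve hψ x
  have h0 : (0 : E) ∈ e.target := hx0 ▸ e.map_source hx
  have hsymm : e.symm 0 = x := by rw [← hx0, e.left_inv hx]
  obtain ⟨R, hR, hRT⟩ := Metric.nhds_basis_closedBall.mem_iff.1 (e.open_target.mem_nhds h0)
  -- If the orbit of `g x` meets the transversal ball of radius `R` at `w`, then `w ≠ 0`, since `0`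
  -- represents the orbit of `x`. An orbit meets the transversal at most once, so the radius `‖w‖ /
  -- 2` excludes `g x`.
  obtain ⟨r, hr, hrT, hgr⟩ : ∃ r > 0, Metric.closedBall (0 : E) r ⊆ e.target ∧
      g.1 x ∉ saturatedBall ψ e e₀ c r := by
    by_cases hgR : g.1 x ∈ saturatedBall ψ e e₀ c R
    · obtain ⟨w, hw, hwp, t, ht⟩ := hgR
      have hw0 : w ≠ 0 := by
        rintro rfl
        exact hcon ⟨t, by rw [← ht, hsymm]⟩
      have hwR : ‖w‖ ≤ R := by simpa using hw
      have hwpos : 0 < ‖w‖ := norm_pos_iff.2 hw0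
      have hsub : Metric.closedBall (0 : E) (‖w‖ / 2) ⊆ e.target :=
        (Metric.closedBall_subset_closedBall (by linarith)).trans hRT
      refine ⟨‖w‖ / 2, by positivity, hsub, ?_⟩
      rintro ⟨w', hw', hwp', t', ht'⟩
      have hwT : w ∈ e.target := hRT hw
      have hwT' : w' ∈ e.target := hsub hw'
      have h1 : ψ (-t' + t) (cylinderMap ψ e e₀ c w) = cylinderMap ψ e e₀ c w' := by
        rw [hbox.cylinderMap_eq hwT, hbox.cylinderMap_eq hwT', ψ.map_add, ht, ← ht', ← ψ.map_add,
          neg_add_cancel, ψ.map_zero_apply]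
      have h2 := hbox.eq_add_of_cylinderMap_eq (hbox.projKer_mem w hwT)
        (hbox.projKer_mem w' hwT') h1
      rw [hwp, hwp'] at h2
      rw [h2] at hw'
      have h3 : ‖w‖ ≤ ‖w‖ / 2 := by simpa using hw'
      linarith
    · exact ⟨R, hR, hRT, hgR⟩
  obtain ⟨f, hf0, hfix, t, ht⟩ :=
    exists_cosymp_isotopy hcos hξ hE hbox h.straightens hT2 hr hrT hv₀
  rw [hsymm] at ht
  apply ht
  -- Since `f t` fixes `g x`, commutation gives `g (f t x) = g x`, and injectivity contradicts `f t
  -- x ≠ x`.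
  have h1 : g.1 ((f t).1 x) = (f t).1 (g.1 x) :=
    DFunLike.congr_fun (congrArg Subtype.val (hg.2 (f t) (hf0 t))) x
  rw [hfix t _ hgr] at h1
  exact g.1.injective h1

theorem image_center_eq [ConnectedSpace M] (h : HasFlowBoxes (M := M) ξ e₀ c)
    (hcos : IsCosymplectic n η Ω) (hξ : IsReebField η Ω ξ)
    (hE : Module.finrank ℝ E = 2 * n + 1) (hT2 : T2Space (OrbitSpace ξ))
    (hcurve : ∀ x : M, IsMIntegralCurve (I := 𝓘(ℝ, E)) (fun t => ψ t x) ξ)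
    (hψ : ContMDiff (𝓘(ℝ, ℝ).prod 𝓘(ℝ, E)) 𝓘(ℝ, E) ∞ (fun q : ℝ × M => ψ q.1 q.2)) :
    (fun g : Cosymp η Ω => (g.1 : M → M)) '' centerCosymp₀ η Ω =
      Set.range (fun t : ℝ => (ψ t : M → M)) := by
  have hmem := flowDiff_mem_cosymp hcos hξ hψ hcurve h.straightens
  apply Subset.antisymm
  · rintro _ ⟨g, hg, rfl⟩
    have horb := exists_flow_eq_of_mem_center h hcos hξ hE hT2 hcurve hψ hg
    obtain ⟨x₀⟩ : Nonempty M := inferInstance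
    obtain ⟨τ, hτ⟩ := horb x₀
    refine ⟨τ, funext fun x => ?_⟩
    -- Rigidity for `ψ_{-τ} ∘ g`, which preserves all orbits and fixes `x₀`.
    have hid := eq_id_of_preserves_orbits hcos hξ (e₀ := e₀) (c := c) (fun q => by
        obtain ⟨e, hq, he, hsep, -⟩ := h.exists_box q
        exact ⟨e, hq, he, hsep⟩) h.normalized
      ((Cosymp η Ω).mul_mem (hmem (-τ)) g.2) (fun y => by
        obtain ⟨s, hs⟩ := horb y
        refine (sameOrbit_iff h.straightens hcurve).2 ⟨-τ + s, ?_⟩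
        change ψ (-τ + s) y = ψ (-τ) (g.1 y)
        rw [ψ.map_add, hs]) (x₀ := x₀) (by
        change ψ (-τ) (g.1 x₀) = x₀
        rw [← hτ, ← ψ.map_add, neg_add_cancel, ψ.map_zero_apply]) x
    change ψ (-τ) (g.1 x) = x at hid
    change ψ τ x = g.1 x
    conv_lhs => rw [← hid]
    rw [← ψ.map_add, add_neg_cancel, ψ.map_zero_apply]
  · rintro _ ⟨t, rfl⟩
    refine ⟨⟨flowDiff ψ hψ t, hmem t⟩, ⟨?_, fun g _ => ?_⟩, rfl⟩
    · refine mem_cosymp₀_of_smooth_family (fun t => ⟨flowDiff ψ hψ t, hmem t⟩) ?_ hψ t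
      exact Subtype.ext (Diffeomorph.ext fun x => ψ.map_zero_apply x)
    · refine Subtype.ext (Diffeomorph.ext fun x => ?_)
      exact (apply_flow hcos hξ hE h.straightens hcurve g.2 t x).symm

end CosymplecticIsotopy

/-! ### Regularity in coordinates -/

section Coordinates

variable {m : ℕ} {M : Type*} [TopologicalSpace M]
  [ChartedSpace (EuclideanSpace ℝ (Fin (m + 1))) M]

/-- Cubical images are convex and stable under setting the first coordinate to zero, which is what
the coordinate-free notion needs. -/
theorem IsRegularField.hasFlowBoxes {ξ : ∀ x : M, TangentSpace (𝓡 (m + 1)) x}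
    (hreg : IsRegularField ξ) :
    HasFlowBoxes (M := M) ξ (EuclideanSpace.single 0 1) (EuclideanSpace.proj 0) := by
  refine ⟨by simp, fun p => ?_⟩
  obtain ⟨e, he, hp, hp0, ⟨a, ha, htar⟩, hfield, hslice⟩ := hreg.flowBox p
  refine ⟨e, hp, ⟨he, ?_, hfield⟩, ?_, hp0, ?_⟩
  · rw [htar]
    have : {z : EuclideanSpace ℝ (Fin (m + 1)) | ∀ i, |z i| < a} =
        ⋂ i, EuclideanSpace.proj (𝕜 := ℝ) i ⁻¹' Ioo (-a) a := by
      ext z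
      simp [abs_lt]
    rw [this]
    exact convex_iInter fun i => (convex_Ioo _ _).linear_preimage
      (EuclideanSpace.proj (𝕜 := ℝ) i : EuclideanSpace ℝ (Fin (m + 1)) →L[ℝ] ℝ).toLinearMap
  · intro x hx y hy hxy
    refine ⟨e y 0 - e x 0, ?_⟩
    ext i
    by_cases hi : i = 0
    · subst hi; simp
    · simp [hi, hslice x hx y hy hxy i hi]
  · intro z hz
    rw [htar] at hz ⊢
    intro i
    by_cases hi : i = 0
    · subst hi; simpa [projKer_apply] using ha
    · simpa [projKer_apply, hi] using hz i

end Coordinates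

end Cosymplectic

end

/-! ### The centre of the identity component -/

open Cosymplectic

theorem proposition1 (n : ℕ) {M : Type*} [TopologicalSpace M] [T2Space M]
    [SecondCountableTopology M] [ConnectedSpace M]
    [ChartedSpace (EuclideanSpace ℝ (Fin (2 * n + 1))) M]
    [IsManifold (𝓡 (2 * n + 1)) ∞ M]
    (η : DiffForm (EuclideanSpace ℝ (Fin (2 * n + 1))) M 1)
    (Ω : DiffForm (EuclideanSpace ℝ (Fin (2 * n + 1))) M 2)
    (hcos : IsCosymplectic n η Ω)
    (ξ : ∀ x : M, TangentSpace (𝓡 (2 * n + 1)) x) (hξ : IsReebField η Ω ξ)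
    (hreg : IsRegularField ξ) :
    ∃ ψ : Flow ℝ M,
      (∀ x : M, IsMIntegralCurve (I := 𝓡 (2 * n + 1)) (fun t => ψ t x) ξ) ∧
      (fun g : Cosymp η Ω => (g.1 : M → M)) '' centerCosymp₀ η Ω =
        Set.range (fun t : ℝ => (ψ t : M → M)) := by
  have hbox := hreg.hasFlowBoxes
  obtain ⟨ψ, hcurve, hψ⟩ := exists_smooth_flow_of_complete hbox.straightens hreg.complete
  exact ⟨ψ, hcurve, image_center_eq hbox hcos hξ (by simp) hreg.hausdorff hcurve hψ⟩
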